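/- Let $n\ge 2$ and write points of $\mathbb{R}^n$ as $x=(x',x_n)$. There is a constant $\rho_0\in(0,\tfrac12]$, depending only on $n$, such that the following holds for every $\rho\in(0,\rho_0)$. Let $\Omega=B_\rho(\rho e_n)$ and $\varphi(x)=\dfrac{x_n}{-\log x_n}$ for $x\in\partial\Omega\setminus\{0\}$, $\varphi(0)=0$. Then $\varphi\in C^2(\partial\Omega)$, and the Dirichlet problem $$\det D^2u=1\ \text{ in }\Omega,\qquad u=\varphi\ \text{ on }\partial\Omega$$ has a convex solution $u\in C(\overline\Omega)$, where the equation is understood in the sense of Alexandrov: $|\partial u(A)|=|A|$ for every Borel set $A\subset\Omega$, $\partial u(A)$ being the set of all slopes of supporting hyperplanes to the graph of $u$ over $\Omega$ at points of $A$. Every such solution $u$ has the following properties. (a) $\nabla u(0)=0$; in particular $u_n(0)=0$. Here $\nabla u(0)$ is the vector $p$ such that $u(0)+p\cdot x\le u(x)$ for all $x\in\overline\Omega$, while for every $\varepsilon>0$ this fails with $p+\varepsilon e_n$ in place of $p$; the vector $p=0$ is the only one with this property. Moreover $\lim_{t\to0^+}\big(u(te_n)-u(0)\big)/t=0$. (b)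 $u(0,x_n)\ge \dfrac{x_n}{2(-\log x_n)}$ for $0<x_n\le 2\rho$. (c) For every $\delta\in(0,1)$, $u\notin C^{1,\delta}(0)$, that is, there is no polynomial $P$ of degree at most $1$ with $u(x)=P(x)+O(|x|^{1+\delta})$ as $x\to0$, $x\in\overline\Omega$. Also $u\notin C^{1,\delta}(\overline\Omega)$, that is, it is not the case that $u$ is differentiable in $\Omega$ with $\nabla u$ uniformly $\delta$-Hölder continuous in $\Omega$. Consequently, the global $C^{1,\beta}(\overline\Omega)$ estimate, which holds for convex solutions of $\det D^2u=f$, $0<\lambda\le f\le\Lambda$, in uniformly convex domains with $\partial\Omega,\varphi\in C^{2,\alpha}$, fails if the boundary data $\varphi$ are only of class $C^2$. -/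

import Mathlib

open Set Filter Topology MeasureTheory Asymptotics

noncomputable section

namespace MongeAmpere

/-- The space `ℝⁿ` with its Euclidean norm. -/
abbrev Eucl (n : ℕ) : Type := EuclideanSpace ℝ (Fin n)

/-- The affine function `x ↦ u x₀ + p · (x - x₀)` supports the graph of `u` over the set `S`
at the point `x₀`, that is, `p` is a subgradient of `u` at `x₀` relative to `S`. -/
def IsSubgradient {n : ℕ} (S : Set (Eucl n)) (u : Eucl n → ℝ) (x₀ p : Eucl n) : Prop :=
  ∀ x ∈ S, u x₀ + inner ℝ p (x - x₀) ≤ u x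

/-- The image `∂u(A)` of a set `A` under the subdifferential of `u` relative to `Ω`. -/
def subgradientImage {n : ℕ} (Ω : Set (Eucl n)) (u : Eucl n → ℝ) (A : Set (Eucl n)) :
    Set (Eucl n) :=
  {p | ∃ x ∈ A, IsSubgradient Ω u x p}

/-- `det D²u = f` in `Ω` in the generalized sense of Alexandrov: the Monge-Ampère measure
`A ↦ |∂u(A)|` of `u` on the Borel subsets `A` of `Ω` is `f dx`. -/
def DetHessianEq {n : ℕ} (Ω : Set (Eucl n)) (f u : Eucl n → ℝ) : Prop :=
  ∀ A : Set (Eucl n), MeasurableSet A → A ⊆ Ω →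
    volume (subgradientImage Ω u A) = ∫⁻ x in A, ENNReal.ofReal (f x)

/-- `u` is a convex, continuous solution on `closure Ω` of the Dirichlet problem
`det D²u = f` in `Ω`, `u = φ` on `∂Ω`. Only the values of `u` on `closure Ω` and those of `φ`
on `∂Ω` matter. -/
structure IsDirichletSolution {n : ℕ} (Ω : Set (Eucl n)) (f φ u : Eucl n → ℝ) : Prop where
  convexOn : ConvexOn ℝ (closure Ω) u
  continuousOn : ContinuousOn u (closure Ω)
  detHessian_eq : DetHessianEq Ω f u
  eq_boundary : ∀ x ∈ frontier Ω, u x = φ x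

/-- `p` is the gradient at the boundary point `x₀` of a function `u` on `S` (a closed convex set
with unit inner normal `ν` at `x₀`): the plane of slope `p` through `(x₀, u x₀)` supports the graph
of `u`, and none of the planes of slope `p + ε ν` with `ε > 0` does. -/
def IsBoundaryGradient {n : ℕ} (S : Set (Eucl n)) (u : Eucl n → ℝ) (x₀ ν p : Eucl n) : Prop :=
  IsSubgradient S u x₀ p ∧ ∀ ε : ℝ, 0 < ε → ¬ IsSubgradient S u x₀ (p + ε • ν)

/-- `u`, as a function on `S`, is pointwise `C^{k,α}` at `x₀`: there is a polynomial `P` of degree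
at most `k` with `u x = P x + O(|x - x₀|^{k + α})` as `x → x₀` in `S`. -/
def PointwiseHolder {n : ℕ} (k : ℕ) (α : ℝ) (S : Set (Eucl n)) (u : Eucl n → ℝ)
    (x₀ : Eucl n) : Prop :=
  ∃ P : MvPolynomial (Fin n) ℝ, P.totalDegree ≤ k ∧
    (fun x : Eucl n => u x - MvPolynomial.eval (fun i => x i) P)
      =O[𝓝[S] x₀] (fun x : Eucl n => ‖x - x₀‖ ^ ((k : ℝ) + α))

/-- `u ∈ C^{1,α}(closure Ω)` for an open set `Ω` and a function `u` that is continuous on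
`closure Ω`: `u` is differentiable in `Ω` and its gradient is `α`-Hölder continuous in `Ω` (and so
extends to an `α`-Hölder continuous map on `closure Ω`). -/
def GloballyC1Holder {n : ℕ} (α : ℝ) (Ω : Set (Eucl n)) (u : Eucl n → ℝ) : Prop :=
  (∀ x ∈ Ω, DifferentiableAt ℝ u x) ∧
    ∃ C : ℝ, ∀ x ∈ Ω, ∀ y ∈ Ω, ‖gradient u x - gradient u y‖ ≤ C * ‖x - y‖ ^ α

/-- `φ ∈ C²(M)` for a smooth hypersurface `M`: near every point of `M`, the restriction of `φ` to
`M` coincides with a `C²` function on an open set of the ambient space. -/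
def C2OnHypersurface {n : ℕ} (M : Set (Eucl n)) (φ : Eucl n → ℝ) : Prop :=
  ∀ x ∈ M, ∃ U : Set (Eucl n), IsOpen U ∧ x ∈ U ∧
    ∃ ψ : Eucl n → ℝ, ContDiffOn ℝ 2 ψ U ∧ ∀ y ∈ U ∩ M, φ y = ψ y

/-- The last basis vector `e_n` of `ℝⁿ`, with `n = d + 1`. -/
def lastVec (d : ℕ) : Eucl (d + 1) := EuclideanSpace.single (Fin.last d) 1

/-- The ball `B_ρ(ρ e_n)`. -/
def tangentBall (d : ℕ) (ρ : ℝ) : Set (Eucl (d + 1)) := Metric.ball (ρ • lastVec d) ρ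

/-- The boundary data `x_n / (- log x_n)`. At `x_n = 0` the value is `0 = lim s / (- log s)`, by
Lean's conventions `log 0 = 0` and `0 / 0 = 0`. -/
def logData (d : ℕ) (x : Eucl (d + 1)) : ℝ :=
  x (Fin.last d) / (-Real.log (x (Fin.last d)))

end MongeAmpere

end

/-! Everything rests on the barrier `w = q(x) / (-log x_n)` with `q = x_n/2 + |x|²/(4ρ)`. On the
sphere `q = x_n`, so `w` has the prescribed boundary values. Its Hessian is positive definite in the
ball (`inner_barrierHess_pos`), and for small `ρ` its determinant is at least `2`
(`IsSmallRadius.two_le_det_barrierHess`). Comparison (`IsDirichletSolution.le_of_subsolution`) then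
puts every solution above `w`, which on the axis gives `u(t e_n) ≥ t / (2(-log t))`. In the other
direction, `t e_n` is the midpoint of two boundary points at height `t`, so convexity gives `u(t
e_n) ≤ t / (-log t)` (`IsTrapped.axis_le`). Hence `u(t e_n)/t` tends to `0`, but more slowly than
any power of `t`. So the gradient at `0` vanishes, and no Hölder rate is possible for it.

Existence is variational. Minimise `∫_Ω z + ∫_{B_R} z*` over continuous `z ≥ w` with the boundary
values of `w`, where `z*` is the Legendre transform. The first variation says that `∇z*` pushes
Lebesgue measure on `B_R` forward to a measure which is at most Lebesgue measure on `Ω`, with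
equality off the contact set with `w`. On the contact set equality follows because `w` is a
subsolution. This pushforward is the Monge-Ampère measure of the minimiser
(`exists_isDirichletSolution`).

The data are `C²` because on the sphere `x_n` may be replaced by `|x|²/(2ρ)`. The second derivative
of `s / (-log s)` blows up at `0`, but its product with `s` tends to `0` (`contDiffOn_radialData`).
-/

noncomputable section

namespace MongeAmpere

/-! ### Legendre transforms on a compact set and biconjugates with truncated slopes. -/

section

variable {n : ℕ} {K : Set (Eucl n)}

/-- The Legendre transform of a function `z` on a set `K`. -/
def legendre (z : K → ℝ) (p : Eucl n) : ℝ := ⨆ x : K, (inner ℝ p (x : Eucl n) - z x)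

theorem legendre_le [Nonempty K] {z : K → ℝ} {p : Eucl n} {a : ℝ}
    (h : ∀ x : K, inner ℝ p (x : Eucl n) - z x ≤ a) : legendre z p ≤ a :=
  ciSup_le h

section Compact

variable [CompactSpace K] {z w : K → ℝ}

theorem le_legendre (hz : Continuous z) (p : Eucl n) (x : K) :
    inner ℝ p (x : Eucl n) - z x ≤ legendre z p :=
  le_ciSup (f := fun x : K => inner ℝ p (x : Eucl n) - z x)
    (isCompact_range (by fun_prop)).bddAbove x

theorem exists_legendre_eq [Nonempty K] (hz : Continuous z) (p : Eucl n) :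
    ∃ x : K, legendre z p = inner ℝ p (x : Eucl n) - z x := by
  obtain ⟨x, -, hx⟩ := isCompact_univ.exists_isMaxOn (univ_nonempty (α := K))
    (f := fun x : K => inner ℝ p (x : Eucl n) - z x) (by fun_prop)
  exact ⟨x, le_antisymm (legendre_le fun y => hx (mem_univ y)) (le_legendre hz p x)⟩

theorem legendre_le_add [Nonempty K] (hz : Continuous z) {c : ℝ}
    (h : ∀ x, z x ≤ w x + c) (p : Eucl n) : legendre w p ≤ legendre z p + c :=
  legendre_le fun x => by linarith [le_legendre hz p x, h x]

theorem legendre_anti [Nonempty K] (hz : Continuous z) (h : ∀ x, z x ≤ w x) (p : Eucl n) :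
    legendre w p ≤ legendre z p := by
  simpa using legendre_le_add hz (c := 0) (by simpa using h) p

theorem abs_legendre_sub_le [Nonempty K] (hz : Continuous z) (hw : Continuous w) {c : ℝ}
    (h : ∀ x, |w x - z x| ≤ c) (p : Eucl n) : |legendre w p - legendre z p| ≤ c := by
  have h1 := legendre_le_add (w := w) (c := c) hz
    (fun x => by linarith [(abs_le.1 (h x)).1]) p
  have h2 := legendre_le_add (w := z) (c := c) hw
    (fun x => by linarith [(abs_le.1 (h x)).2]) p
  exact abs_le.2 ⟨by linarith, by linarith⟩

theorem lipschitzWith_legendre [Nonempty K] (hz : Continuous z) {M : NNReal}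
    (hM : ∀ x : K, ‖(x : Eucl n)‖ ≤ M) : LipschitzWith M (legendre z) := by
  refine LipschitzWith.of_le_add_mul M fun p q => ?_
  refine legendre_le fun x => ?_
  have h1 := le_legendre hz q x
  have h2 : inner ℝ p (x : Eucl n) = inner ℝ q (x : Eucl n) + inner ℝ (p - q) (x : Eucl n) := by
    rw [inner_sub_left]; ring
  have h3 : inner ℝ (p - q) (x : Eucl n) ≤ M * dist p q := by
    refine (real_inner_le_norm _ _).trans ?_
    rw [dist_eq_norm, mul_comm]
    exact mul_le_mul_of_nonneg_right (hM x) (norm_nonneg _)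
  linarith

theorem convexOn_legendre [Nonempty K] (hz : Continuous z) : ConvexOn ℝ univ (legendre z) := by
  refine ⟨convex_univ, fun p _ q _ a b ha hb hab => legendre_le fun x => ?_⟩
  have h1 := mul_le_mul_of_nonneg_left (le_legendre hz p x) ha
  have h2 := mul_le_mul_of_nonneg_left (le_legendre hz q x) hb
  have h3 : z x = a * z x + b * z x := by rw [← add_mul, hab, one_mul]
  simp only [inner_add_left, real_inner_smul_left, smul_eq_mul]
  linarith

/-- If `x` attains the supremum at `p`, then `q ↦ legendre z q - q · x` has a minimum at `p`. In
particular the maximiser is unique wherever the transform is differentiable. -/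
theorem gradient_legendre_eq (hz : Continuous z) {p : Eucl n}
    (hp : DifferentiableAt ℝ (legendre z) p) {x : K}
    (hx : legendre z p = inner ℝ p (x : Eucl n) - z x) :
    gradient (legendre z) p = x := by
  have h1 : IsLocalMin (fun q => legendre z q - inner ℝ q (x : Eucl n)) p := by
    refine Eventually.of_forall fun q => ?_
    have := le_legendre hz q x
    simp only [hx]
    linarith
  have h2 : HasGradientAt (fun q : Eucl n => inner ℝ q (x : Eucl n)) (x : Eucl n) p := by
    rw [hasGradientAt_iff_hasFDerivAt]
    have := ((InnerProductSpace.toDual ℝ (Eucl n)) (x : Eucl n)).hasFDerivAt (x := p)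
    refine this.congr_of_eventuallyEq (Eventually.of_forall fun q => ?_)
    simp [real_inner_comm]
  have h3 := h1.hasFDerivAt_eq_zero (hp.hasGradientAt.hasFDerivAt.sub h2.hasFDerivAt)
  rw [← map_sub, LinearIsometryEquiv.map_eq_zero_iff, sub_eq_zero] at h3
  exact h3

theorem measurable_gradient (f : Eucl n → ℝ) : Measurable (gradient f) :=
  (InnerProductSpace.toDual ℝ (Eucl n)).symm.continuous.measurable.comp (measurable_fderiv ℝ f)

theorem ae_differentiableAt_legendre [Nonempty K] (hz : Continuous z) :
    ∀ᵐ p : Eucl n, DifferentiableAt ℝ (legendre z) p := by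
  obtain ⟨M, hM⟩ := (isCompact_iff_compactSpace.2 ‹CompactSpace K›).isBounded.exists_norm_le
  refine (lipschitzWith_legendre hz (M := M.toNNReal) fun x => ?_).ae_differentiableAt
  exact (hM x x.2).trans (Real.le_coe_toNNReal M)

/-- The derivative of the Legendre transform with respect to the function being transformed. -/
theorem tendsto_legendre_slope [Nonempty K] (hz : Continuous z) {f : Eucl n → ℝ}
    (hf : Continuous f) {p : Eucl n} (hp : DifferentiableAt ℝ (legendre z) p)
    {ε : ℕ → ℝ} (hε : ∀ k, 0 < ε k) (hε0 : Tendsto ε atTop (𝓝 0)) :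
    Tendsto (fun k => (ε k)⁻¹ * (legendre (fun x : K => z x + ε k * f x) p - legendre z p)) atTop
      (𝓝 (-f (gradient (legendre z) p))) := by
  have hzk : ∀ k, Continuous fun x : K => z x + ε k * f x := fun k => by fun_prop
  choose y hy using fun k => exists_legendre_eq (hzk k) p
  obtain ⟨x, hx⟩ := exists_legendre_eq hz p
  rw [gradient_legendre_eq hz hp hx]
  -- Each of the two suprema is tested with the maximiser of the other; this traps the difference
  -- quotient between `-f x` and `-f (y k)`.
  have hle : ∀ k, legendre (fun x : K => z x + ε k * f x) p - legendre z p ≤ -(ε k * f (y k)) := by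
    intro k
    have := le_legendre hz p (y k)
    rw [hy k]; linarith
  have hge : ∀ k, -(ε k * f x) ≤ legendre (fun x : K => z x + ε k * f x) p - legendre z p := by
    intro k
    have := le_legendre (hzk k) p x
    rw [hx]; linarith
  obtain ⟨C, hC⟩ := isCompact_univ.exists_bound_of_continuousOn
    (f := fun x : K => f x) (by fun_prop)
  have hlim : Tendsto (fun k => inner ℝ p (y k : Eucl n) - z (y k)) atTop (𝓝 (legendre z p)) := by
    refine tendsto_of_tendsto_of_tendsto_of_le_of_le (g := fun k => legendre z p - 2 * C * ε k)
      (h := fun _ => legendre z p) ?_ tendsto_const_nhds (fun k => ?_)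
      (fun k => le_legendre hz p (y k))
    · simpa using (hε0.const_mul (2 * C)).const_sub (legendre z p)
    · have h1 := hge k
      have h2 := abs_le.1 (hC (y k) (mem_univ _))
      have h3 := abs_le.1 (hC x (mem_univ _))
      have h4 := mul_le_mul_of_nonneg_left h2.1 (hε k).le
      have h5 := mul_le_mul_of_nonneg_left h3.2 (hε k).le
      rw [hy k] at h1
      simp only
      linarith
  -- By compactness it suffices that every cluster point of `y` is `x`. A cluster point is again a
  -- maximiser at `p`, and that maximiser is unique.
  have hyx : Tendsto y atTop (𝓝 x) := by
    refine tendsto_nhds_of_unique_mapClusterPt fun x' hx' => ?_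
    have hcont : Continuous fun x : K => inner ℝ p (x : Eucl n) - z x := by fun_prop
    have hc : MapClusterPt (inner ℝ p (x' : Eucl n) - z x') atTop
        (fun k => inner ℝ p (y k : Eucl n) - z (y k)) :=
      hx'.continuousAt_comp hcont.continuousAt
    have := eq_of_nhds_neBot (hc.neBot.mono (inf_le_inf_left _ hlim))
    exact Subtype.ext ((gradient_legendre_eq hz hp this.symm).symm.trans
      (gradient_legendre_eq hz hp hx))
  refine tendsto_of_tendsto_of_tendsto_of_le_of_le (g := fun _ => -f x)
    (h := fun k => -f (y k)) tendsto_const_nhds ?_ (fun k => ?_) (fun k => ?_)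
  · exact ((hf.comp continuous_subtype_val).tendsto x |>.comp hyx).neg
  · have := mul_le_mul_of_nonneg_left (hge k) (inv_pos.2 (hε k)).le
    have h2 : (ε k)⁻¹ * -(ε k * f x) = -f x := by field_simp [(hε k).ne']
    simp only; linarith
  · have := mul_le_mul_of_nonneg_left (hle k) (inv_pos.2 (hε k)).le
    have h2 : (ε k)⁻¹ * -(ε k * f (y k)) = -f (y k) := by field_simp [(hε k).ne']
    simp only; linarith

theorem abs_legendre_slope_le [Nonempty K] (hz : Continuous z) {f : Eucl n → ℝ}
    (hf : Continuous f) {C : ℝ} (hC : ∀ x : K, |f x| ≤ C) {ε : ℝ} (hε : 0 < ε) (p : Eucl n) :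
    |ε⁻¹ * (legendre (fun x : K => z x + ε * f x) p - legendre z p)| ≤ C := by
  rw [abs_mul, abs_of_pos (inv_pos.2 hε), inv_mul_le_iff₀ hε]
  refine abs_legendre_sub_le hz (by fun_prop) (fun x => ?_) p
  rw [add_sub_cancel_left, abs_mul, abs_of_pos hε]
  exact mul_le_mul_of_nonneg_left (hC x) hε.le

end Compact

section Biconj

/-- The largest function below `z` that is a supremum of affine functions with slopes in the
closed ball of radius `R`. -/
def biconj (R : ℝ) (z : K → ℝ) (x : Eucl n) : ℝ :=
  legendre (fun p : Metric.closedBall (0 : Eucl n) R => legendre z p) x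

variable [CompactSpace K] [Nonempty K] {z : K → ℝ} {R : ℝ}

instance compactSpace_closedBall (R : ℝ) : CompactSpace (Metric.closedBall (0 : Eucl n) R) :=
  isCompact_iff_compactSpace.1 (isCompact_closedBall _ _)

theorem nonempty_closedBall (hR : 0 ≤ R) : Nonempty (Metric.closedBall (0 : Eucl n) R) :=
  ⟨⟨0, by simpa using hR⟩⟩

theorem continuous_legendre (hz : Continuous z) : Continuous (legendre z) := by
  obtain ⟨M, hM⟩ := (isCompact_iff_compactSpace.2 ‹CompactSpace K›).isBounded.exists_norm_le
  exact (lipschitzWith_legendre hz (M := M.toNNReal)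
    fun x => (hM x x.2).trans (Real.le_coe_toNNReal M)).continuous

theorem continuous_legendre_restrict (hz : Continuous z) :
    Continuous fun p : Metric.closedBall (0 : Eucl n) R => legendre z p :=
  (continuous_legendre hz).comp continuous_subtype_val

theorem le_biconj (hz : Continuous z) {p : Eucl n} (hp : ‖p‖ ≤ R) (x : Eucl n) :
    inner ℝ p x - legendre z p ≤ biconj R z x := by
  have := le_legendre (continuous_legendre_restrict (R := R) hz) x ⟨p, by simpa using hp⟩
  rwa [real_inner_comm] at this

omit [Nonempty K] in
theorem biconj_le (hR : 0 ≤ R) (hz : Continuous z) (x : K) : biconj R z x ≤ z x := by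
  have := nonempty_closedBall (n := n) hR
  refine legendre_le fun p => ?_
  have := le_legendre hz p x
  rw [real_inner_comm]
  linarith

theorem lipschitzWith_biconj {R : NNReal} (hz : Continuous z) : LipschitzWith R (biconj R z) := by
  have := nonempty_closedBall (n := n) R.coe_nonneg
  exact lipschitzWith_legendre (continuous_legendre_restrict hz) fun p => mem_closedBall_zero_iff.1 p.2

theorem convexOn_biconj (hR : 0 ≤ R) (hz : Continuous z) : ConvexOn ℝ univ (biconj R z) := by
  have := nonempty_closedBall (n := n) hR
  exact convexOn_legendre (continuous_legendre_restrict hz)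

/-- The plane of slope `p` and height `-legendre z p` is one of those whose supremum is `biconj R
z`. Truncating slopes thus does not change the transform on the ball where the energy sees it. -/
theorem legendre_biconj {R : NNReal} (hz : Continuous z) {p : Eucl n} (hp : ‖p‖ ≤ R) :
    legendre (fun x : K => biconj R z x) p = legendre z p := by
  refine le_antisymm (legendre_le fun x => ?_)
    (legendre_anti ((lipschitzWith_biconj hz).continuous.comp continuous_subtype_val)
      (biconj_le R.2 hz) p)
  linarith [le_biconj hz hp (x : Eucl n)]

/-- A supporting plane of `z₀` also lies below `z`, so it competes in the supremum. This keeps the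
biconjugate above the obstacle. -/
theorem le_biconj_of_isSubgradient {z₀ : Eucl n → ℝ} (hz : Continuous z)
    (hle : ∀ x : K, z₀ x ≤ z x) {x p : Eucl n} (hp : ‖p‖ ≤ R) (hsub : IsSubgradient K z₀ x p) :
    z₀ x ≤ biconj R z x := by
  refine le_trans ?_ (le_biconj hz hp x)
  have : legendre z p ≤ inner ℝ p x - z₀ x := legendre_le fun y => by
    have h1 := hsub y y.2
    rw [inner_sub_right] at h1
    linarith [hle y]
  linarith

end Biconj

end

/-! ### The dual energy: minimisers and first variation. -/

section

variable {n : ℕ}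

section Energy

variable {Ω : Set (Eucl n)}

/-- Lebesgue measure on `Ω`, as a measure on the subtype `closure Ω`. -/
def closureVolume (Ω : Set (Eucl n)) : Measure (closure Ω) :=
  (volume.restrict Ω).comap Subtype.val

/-- The functional minimised by the solution of the Dirichlet problem. -/
def dualEnergy (R : ℝ) (Ω : Set (Eucl n)) (z : closure Ω → ℝ) : ℝ :=
  (∫ x, z x ∂closureVolume Ω) + ∫ p in Metric.closedBall 0 R, legendre z p

/-- Continuous competitors above the obstacle `z₀` having its boundary values. -/
structure IsAdmissible (Ω : Set (Eucl n)) (z₀ : Eucl n → ℝ) (z : closure Ω → ℝ) : Prop where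
  continuous : Continuous z
  le : ∀ x : closure Ω, z₀ x ≤ z x
  eq_frontier : ∀ x : closure Ω, (x : Eucl n) ∈ frontier Ω → z x = z₀ x

theorem map_closureVolume (Ω : Set (Eucl n)) :
    (closureVolume Ω).map Subtype.val = volume.restrict Ω := by
  have he : MeasurableEmbedding (Subtype.val : closure Ω → Eucl n) :=
    MeasurableEmbedding.subtype_coe isClosed_closure.measurableSet
  rw [closureVolume, he.map_comap, Subtype.range_coe,
    Measure.restrict_restrict isClosed_closure.measurableSet,
    inter_eq_right.2 subset_closure]

theorem integral_closureVolume (f : Eucl n → ℝ) :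
    ∫ x, f x ∂closureVolume Ω = ∫ x in Ω, f x := by
  rw [← map_closureVolume Ω, (MeasurableEmbedding.subtype_coe
    isClosed_closure.measurableSet).integral_map]

theorem isFiniteMeasure_closureVolume (hb : Bornology.IsBounded Ω) :
    IsFiniteMeasure (closureVolume Ω) := by
  have : IsFiniteMeasure (volume.restrict Ω) := ⟨by simpa using hb.measure_lt_top⟩
  rw [← map_closureVolume Ω] at this
  exact ⟨by simpa [Measure.map_apply measurable_subtype_coe MeasurableSet.univ] using
    this.measure_univ_lt_top⟩

variable [CompactSpace (closure Ω)] [Nonempty (closure Ω)] {z₀ : Eucl n → ℝ} {R : NNReal}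

theorem integrableOn_legendre {z : closure Ω → ℝ} (hz : Continuous z) (R : ℝ) :
    IntegrableOn (legendre z) (Metric.closedBall 0 R) :=
  (continuous_legendre hz).continuousOn.integrableOn_compact (isCompact_closedBall _ _)

omit [Nonempty (closure Ω)] in
theorem integrable_closureVolume [IsFiniteMeasure (closureVolume Ω)] {z : closure Ω → ℝ}
    (hz : Continuous z) : Integrable z (closureVolume Ω) :=
  hz.integrable_of_hasCompactSupport (HasCompactSupport.of_compactSpace z)

theorem continuous_dualEnergy [IsFiniteMeasure (closureVolume Ω)] (R : ℝ) :
    Continuous fun z : BoundedContinuousFunction (closure Ω) ℝ => dualEnergy R Ω z := by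
  refine Continuous.add ?_ ?_
  · refine (LipschitzWith.of_dist_le_mul
      (K := (closureVolume Ω univ).toNNReal) fun z w => ?_).continuous
    rw [dist_eq_norm, ← integral_sub (integrable_closureVolume z.continuous)
      (integrable_closureVolume w.continuous), mul_comm]
    exact norm_integral_le_of_norm_le_const (Eventually.of_forall fun x => z.dist_coe_le_dist x)
  · refine (LipschitzWith.of_dist_le_mul
      (K := (volume (Metric.closedBall (0 : Eucl n) R)).toNNReal) fun z w => ?_).continuous
    rw [dist_eq_norm, ← integral_sub (integrableOn_legendre z.continuous R)
      (integrableOn_legendre w.continuous R), mul_comm]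
    refine norm_setIntegral_le_of_norm_le_const measure_closedBall_lt_top fun p _ => ?_
    refine abs_legendre_sub_le w.continuous z.continuous (fun x => ?_) p
    exact z.dist_coe_le_dist x

theorem IsAdmissible.biconj {F : Eucl n → Eucl n} (hz₀ : ContinuousOn z₀ (closure Ω))
    (hF : ∀ x ∈ Ω, IsSubgradient (closure Ω) z₀ x (F x)) (hFR : ∀ x ∈ Ω, ‖F x‖ ≤ R)
    {z : closure Ω → ℝ} (hz : IsAdmissible Ω z₀ z) :
    IsAdmissible Ω z₀ fun x => biconj R z x := by
  have hc := (lipschitzWith_biconj (R := R) hz.continuous).continuous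
  have hle : ∀ x ∈ closure Ω, z₀ x ≤ MongeAmpere.biconj R z x := fun x hx =>
    le_on_closure (fun y hy =>
      le_biconj_of_isSubgradient hz.continuous hz.le (hFR y hy) (hF y hy))
      hz₀ hc.continuousOn hx
  refine ⟨hc.comp continuous_subtype_val, fun x => hle x x.2, fun x hx => ?_⟩
  refine le_antisymm ?_ (hle x x.2)
  rw [← hz.eq_frontier x hx]
  exact biconj_le R.coe_nonneg hz.continuous x

/-- The volume term can only drop, and the Legendre term is unchanged. -/
theorem dualEnergy_biconj_le [IsFiniteMeasure (closureVolume Ω)] {z : closure Ω → ℝ}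
    (hz : Continuous z) : dualEnergy R Ω (fun x => biconj R z x) ≤ dualEnergy R Ω z := by
  refine add_le_add (integral_mono ?_ (integrable_closureVolume hz)
    (biconj_le R.coe_nonneg hz)) (le_of_eq ?_)
  · exact integrable_closureVolume
      ((lipschitzWith_biconj (R := R) hz).continuous.comp continuous_subtype_val)
  · exact setIntegral_congr_fun Metric.isClosed_closedBall.measurableSet fun p hp =>
      legendre_biconj hz (mem_closedBall_zero_iff.1 hp)

/-- Direct method: replacing a competitor by its biconjugate does not raise the energy and makes it
`R`-Lipschitz, so Arzelà–Ascoli applies. -/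
theorem exists_minimizer_dualEnergy [IsFiniteMeasure (closureVolume Ω)]
    (hfr : (frontier Ω).Nonempty) {F : Eucl n → Eucl n} (hz₀ : ContinuousOn z₀ (closure Ω))
    (hF : ∀ x ∈ Ω, IsSubgradient (closure Ω) z₀ x (F x)) (hFR : ∀ x ∈ Ω, ‖F x‖ ≤ R) :
    ∃ u : Eucl n → ℝ, LipschitzWith R u ∧ ConvexOn ℝ univ u ∧
      IsAdmissible Ω z₀ (fun x => u x) ∧
      ∀ z : closure Ω → ℝ, IsAdmissible Ω z₀ z →
        dualEnergy R Ω (fun x => u x) ≤ dualEnergy R Ω z := by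
  let A : Set (BoundedContinuousFunction (closure Ω) ℝ) :=
    {g | LipschitzWith R g ∧ IsAdmissible Ω z₀ g}
  have hmem : ∀ z, IsAdmissible Ω z₀ z → ∃ g ∈ A, ∀ x, g x = biconj R z x := fun z hz =>
    ⟨BoundedContinuousFunction.mkOfCompact
      ⟨fun x => biconj R z x, (hz.biconj hz₀ hF hFR).continuous⟩,
      ⟨((lipschitzWith_biconj (R := R) hz.continuous).comp
        (LipschitzWith.subtype_val _)).weaken (mul_one R).le, hz.biconj hz₀ hF hFR⟩, fun x => rfl⟩
  have hclosed : IsClosed A := by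
    have : A = {g | ∀ x y, dist (g x) (g y) ≤ R * dist x y} ∩ {g | ∀ x : closure Ω, z₀ x ≤ g x} ∩
        {g | ∀ x : closure Ω, (x : Eucl n) ∈ frontier Ω → g x = z₀ x} := by
      ext g
      refine ⟨fun h => ⟨⟨h.1.dist_le_mul, h.2.le⟩, h.2.eq_frontier⟩, fun h =>
        ⟨LipschitzWith.of_dist_le_mul h.1.1, g.continuous, h.1.2, h.2⟩⟩
    rw [this]
    have hev : ∀ x, Continuous fun g : BoundedContinuousFunction (closure Ω) ℝ => g x :=
      fun x => continuous_eval_const x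
    refine IsClosed.inter (IsClosed.inter ?_ ?_) ?_ <;> simp only [ofPred_forall]
    · exact isClosed_iInter fun x => isClosed_iInter fun y =>
        isClosed_le ((hev x).dist (hev y)) continuous_const
    · exact isClosed_iInter fun x => isClosed_le continuous_const (hev x)
    · exact isClosed_iInter fun x => isClosed_iInter fun _ => isClosed_eq (hev x) continuous_const
  obtain ⟨b, hb⟩ := hfr
  have hbd := (isCompact_univ (X := closure Ω)).isBounded
  obtain ⟨D, hD⟩ := Metric.isBounded_iff.1 hbd
  have hcomp : IsCompact A := by
    refine BoundedContinuousFunction.arzela_ascoli₂ (Metric.closedBall (z₀ b) (R * D))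
      (isCompact_closedBall _ _) A hclosed (fun g x hg => ?_) ?_
    · have h1 := hg.1.dist_le_mul x ⟨b, frontier_subset_closure hb⟩
      rw [hg.2.eq_frontier ⟨b, frontier_subset_closure hb⟩ hb] at h1
      exact h1.trans (mul_le_mul_of_nonneg_left (hD (mem_univ _) (mem_univ _)) R.2)
    · exact (LipschitzWith.uniformEquicontinuous _ R fun g => g.2.1).equicontinuous
  have hadm₀ : IsAdmissible Ω z₀ fun x => z₀ x :=
    ⟨continuousOn_iff_continuous_domRestrict.1 hz₀, fun _ => le_rfl, fun _ _ => rfl⟩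
  obtain ⟨g, hgA, hg⟩ := hcomp.exists_isMinOn ((hmem _ hadm₀).imp fun _ h => h.1)
    (continuous_dualEnergy (R : ℝ)).continuousOn
  -- Convexity was not part of the compact class; one more biconjugate of the minimiser supplies it,
  -- together with an extension to all of space.
  refine ⟨biconj R g, lipschitzWith_biconj g.continuous,
    convexOn_biconj R.coe_nonneg g.continuous, hgA.2.biconj hz₀ hF hFR, fun z hz => ?_⟩
  obtain ⟨w, hwA, hw⟩ := hmem z hz
  refine (dualEnergy_biconj_le g.continuous).trans ((hg hwA).trans ?_)
  change dualEnergy R Ω w ≤ _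
  rw [show (w : closure Ω → ℝ) = fun x : closure Ω => biconj R z x from funext hw]
  exact dualEnergy_biconj_le hz.continuous

/-- The first variation of the energy at a minimizer. -/
theorem integral_gradient_legendre_le [IsFiniteMeasure (closureVolume Ω)] {z : closure Ω → ℝ}
    (hz : IsAdmissible Ω z₀ z)
    (hmin : ∀ w : closure Ω → ℝ, IsAdmissible Ω z₀ w → dualEnergy R Ω z ≤ dualEnergy R Ω w)
    {f : Eucl n → ℝ} (hf : Continuous f) (hf0 : ∀ x ∈ frontier Ω, f x = 0)
    (hfz : ∀ ε : ℝ, 0 < ε → ε ≤ 1 → ∀ x : closure Ω, z₀ x ≤ z x + ε * f x) :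
    ∫ p in Metric.closedBall 0 (R : ℝ), f (gradient (legendre z) p) ≤ ∫ x in Ω, f x := by
  have hzc := hz.continuous
  obtain ⟨C, hC⟩ := isCompact_univ.exists_bound_of_continuousOn
    (f := fun x : closure Ω => f x) (by fun_prop)
  let ε : ℕ → ℝ := fun k => 1 / ((k : ℝ) + 1)
  have hε : ∀ k, 0 < ε k := fun k => by positivity
  have hε1 : ∀ k, ε k ≤ 1 := fun k => by
    refine (div_le_one (by positivity)).2 ?_
    linarith [k.cast_nonneg (α := ℝ)]
  have hε0 : Tendsto ε atTop (𝓝 0) := tendsto_one_div_add_atTop_nhds_zero_nat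
  let s : ℕ → Eucl n → ℝ := fun k p =>
    (ε k)⁻¹ * (legendre (fun x : closure Ω => z x + ε k * f x) p - legendre z p)
  have hzk : ∀ k, Continuous fun x : closure Ω => z x + ε k * f x := fun k => by fun_prop
  have hlim : Tendsto (fun k => ∫ p in Metric.closedBall 0 (R : ℝ), s k p) atTop
      (𝓝 (∫ p in Metric.closedBall 0 (R : ℝ), -f (gradient (legendre z) p))) := by
    refine tendsto_integral_of_dominated_convergence (fun _ => C) (fun k => ?_) ?_ (fun k => ?_) ?_
    · exact (((continuous_legendre (hzk k)).sub
        (continuous_legendre hzc)).const_mul _).aestronglyMeasurable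
    · exact integrableOn_const (measure_closedBall_lt_top.ne)
    · exact Eventually.of_forall fun p =>
        abs_legendre_slope_le hzc hf (fun x => hC x (mem_univ _)) (hε k) p
    · filter_upwards [ae_restrict_of_ae (ae_differentiableAt_legendre hzc)] with p hp
      exact tendsto_legendre_slope hzc hf hp hε hε0
  -- Minimality against `z + ε f`, divided by `ε`.
  have hk : ∀ k, 0 ≤ (∫ x in Ω, f x) + ∫ p in Metric.closedBall 0 (R : ℝ), s k p := by
    intro k
    have hfi : Integrable (fun x : closure Ω => f x) (closureVolume Ω) :=
      integrable_closureVolume (by fun_prop)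
    have h1 := hmin (fun x => z x + ε k * f x) ⟨hzk k, hfz _ (hε k) (hε1 k), fun x hx => by
      simp [hf0 _ hx, hz.eq_frontier x hx]⟩
    rw [dualEnergy, dualEnergy, integral_add (integrable_closureVolume hzc) (hfi.const_mul _),
      integral_const_mul, integral_closureVolume f] at h1
    have h2 : ∫ p in Metric.closedBall 0 (R : ℝ), s k p = (ε k)⁻¹ *
        ((∫ p in Metric.closedBall 0 (R : ℝ), legendre (fun x : closure Ω => z x + ε k * f x) p) -
          ∫ p in Metric.closedBall 0 (R : ℝ), legendre z p) := by
      rw [← integral_sub (integrableOn_legendre (hzk k) _) (integrableOn_legendre hzc _),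
        ← integral_const_mul]
    have h3 : (∫ x in Ω, f x) + ∫ p in Metric.closedBall 0 (R : ℝ), s k p = (ε k)⁻¹ *
        (ε k * (∫ x in Ω, f x) +
        ((∫ p in Metric.closedBall 0 (R : ℝ), legendre (fun x : closure Ω => z x + ε k * f x) p) -
          ∫ p in Metric.closedBall 0 (R : ℝ), legendre z p)) := by
      rw [h2, mul_add, inv_mul_cancel_left₀ (hε k).ne']
    rw [h3]
    exact mul_nonneg (inv_pos.2 (hε k)).le (by linarith)
  have h := ge_of_tendsto' (hlim.const_add (∫ x in Ω, f x)) hk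
  rw [integral_neg] at h
  linarith

end Energy

/-- Two finite measures are ordered on an open set if the integrals of cut-off functions are. -/
theorem measure_le_of_forall_integral_le {μ ν : Measure (Eucl n)} [IsFiniteMeasure μ]
    [IsFiniteMeasure ν] {U : Set (Eucl n)} (hU : IsOpen U)
    (h : ∀ C : Set (Eucl n), IsCompact C → C ⊆ U → ∀ f : Eucl n → ℝ, Continuous f →
      (∀ x, 0 ≤ f x) → (∀ x, f x ≤ 1) → (∀ x ∉ C, f x = 0) → ∫ x, f x ∂μ ≤ ∫ x, f x ∂ν)
    {A : Set (Eucl n)} (hA : MeasurableSet A) (hAU : A ⊆ U) : μ A ≤ ν A := by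
  rw [hA.measure_eq_iSup_isCompact μ]
  refine iSup_le fun C => iSup_le fun hCA => iSup_le fun hC => le_trans ?_ (measure_mono hCA)
  -- By inner regularity only compact `C` matter. Thickened indicators of `C` with radii at most `δ`
  -- are cut-offs supported in `U`, and their integrals converge to the measure of `C`.
  obtain ⟨δ, hδ, hδU⟩ := hC.exists_cthickening_subset_open hU (hCA.trans hAU)
  let δs : ℕ → ℝ := fun k => δ * (1 / ((k : ℝ) + 1))
  have hδs : ∀ k, 0 < δs k := fun k => by positivity
  have hδs' : ∀ k, δs k ≤ δ := fun k => by
    refine mul_le_of_le_one_right hδ.le ((div_le_one (by positivity)).2 ?_)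
    linarith [k.cast_nonneg (α := ℝ)]
  have hlim : Tendsto δs atTop (𝓝 0) := by
    simpa [δs] using (tendsto_one_div_add_atTop_nhds_zero_nat (𝕜 := ℝ)).const_mul δ
  refine le_of_tendsto_of_tendsto'
    (tendsto_lintegral_thickenedIndicator_of_isClosed μ hC.isClosed hδs hlim)
    (tendsto_lintegral_thickenedIndicator_of_isClosed ν hC.isClosed hδs hlim) fun k => ?_
  have hint : ∀ m : Measure (Eucl n), IsFiniteMeasure m →
      ∫⁻ x, (thickenedIndicator (hδs k) C x : ENNReal) ∂m =
        ENNReal.ofReal (∫ x, (thickenedIndicator (hδs k) C x : ℝ) ∂m) := by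
    intro m _
    rw [ofReal_integral_eq_lintegral_ofReal]
    · simp
    · refine Integrable.of_bound (C := 1) ?_ (Eventually.of_forall fun x => ?_)
      · exact (NNReal.continuous_coe.comp
          (thickenedIndicator (hδs k) C).continuous).aestronglyMeasurable
      · simpa using thickenedIndicator_le_one (hδs k) C x
    · exact Eventually.of_forall fun x => NNReal.coe_nonneg _
  rw [hint μ inferInstance, hint ν inferInstance]
  refine ENNReal.ofReal_le_ofReal (h (Metric.cthickening δ C) hC.cthickening hδU _
    (NNReal.continuous_coe.comp (thickenedIndicator (hδs k) C).continuous)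
    (fun x => NNReal.coe_nonneg _) (fun x => thickenedIndicator_le_one (hδs k) C x)
    fun x hx => ?_)
  have : x ∉ Metric.thickening (δs k) C := fun hx' =>
    hx (Metric.cthickening_mono (hδs' k) C (Metric.thickening_subset_cthickening _ _ hx'))
  simp [thickenedIndicator_zero (hδs k) C this]

end

/-! ### Existence and comparison for Alexandrov solutions. -/

section

variable {n : ℕ}

/-- A short step from `x` in the direction `p` raises `u` by at least `‖p‖` times its length. -/
theorem norm_le_of_isSubgradient {Ω : Set (Eucl n)} (ho : IsOpen Ω) {u : Eucl n → ℝ} {R : NNReal}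
    (hu : LipschitzWith R u) {x p : Eucl n} (hx : x ∈ Ω) (hp : IsSubgradient Ω u x p) :
    ‖p‖ ≤ R := by
  by_cases hp0 : p = 0
  · simp [hp0]
  have hpos : 0 < ‖p‖ := norm_pos_iff.2 hp0
  obtain ⟨r, hr, hball⟩ := Metric.isOpen_iff.1 ho x hx
  set t : ℝ := r / (2 * ‖p‖)
  have ht : 0 < t := by positivity
  have htp : t * ‖p‖ = r / 2 := by simp only [t]; field_simp
  have hy : x + t • p ∈ Ω := hball (by
    rw [Metric.mem_ball, dist_eq_norm, add_sub_cancel_left, norm_smul, Real.norm_of_nonneg ht.le,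
      htp]
    linarith)
  have h1 := hp _ hy
  have h2 := hu.dist_le_mul (x + t • p) x
  rw [add_sub_cancel_left, real_inner_smul_right, real_inner_self_eq_norm_sq] at h1
  rw [dist_eq_norm (x + t • p), add_sub_cancel_left, norm_smul, Real.norm_of_nonneg ht.le,
    Real.dist_eq] at h2
  have h3 := le_abs_self (u (x + t • p) - u x)
  have h4 : (t * ‖p‖) * ‖p‖ ≤ (t * ‖p‖) * R := by nlinarith
  exact le_of_mul_le_mul_left h4 (by positivity)

theorem IsSubgradient.closure {Ω : Set (Eucl n)} {u : Eucl n → ℝ}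
    (hu : ContinuousOn u (closure Ω)) {x p : Eucl n} (hp : IsSubgradient Ω u x p) :
    IsSubgradient (closure Ω) u x p := fun _ hy =>
  le_on_closure (f := fun y => u x + inner ℝ p (y - x)) hp (by fun_prop) hu hy

/-- The Dirichlet problem `det D²u = 1` has a convex solution if there is a Lipschitz subsolution
with the same boundary values. -/
theorem exists_isDirichletSolution {Ω : Set (Eucl n)} (ho : IsOpen Ω) (hconv : Convex ℝ Ω)
    (hb : Bornology.IsBounded Ω) (hfr : (frontier Ω).Nonempty) {z₀ : Eucl n → ℝ}
    {F : Eucl n → Eucl n} {R : NNReal} (hz₀ : ContinuousOn z₀ (closure Ω))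
    (hF : ∀ x ∈ Ω, IsSubgradient (closure Ω) z₀ x (F x)) (hFR : ∀ x ∈ Ω, ‖F x‖ ≤ R)
    (hvol : ∀ A : Set (Eucl n), MeasurableSet A → A ⊆ Ω → volume A ≤ volume (F '' A)) :
    ∃ u : Eucl n → ℝ, IsDirichletSolution Ω (fun _ => 1) z₀ u := by
  have hKc : IsCompact (closure Ω) := hb.isCompact_closure
  have : CompactSpace (closure Ω) := isCompact_iff_compactSpace.1 hKc
  have : Nonempty (closure Ω) := (hfr.mono frontier_subset_closure).to_subtype
  have := isFiniteMeasure_closureVolume hb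
  have : IsFiniteMeasure (volume.restrict Ω) := ⟨by simpa using hb.measure_lt_top⟩
  obtain ⟨u, huL, huc, hadm, hmin⟩ := exists_minimizer_dualEnergy hfr hz₀ hF hFR
  have huC := huL.continuous
  set z : closure Ω → ℝ := fun x => u x
  have hz : Continuous z := hadm.continuous
  set T := gradient (legendre z)
  set B := Metric.closedBall (0 : Eucl n) R
  set ν := (volume.restrict B).map T
  have hT : Measurable T := measurable_gradient _
  have : IsFiniteMeasure (volume.restrict B) := ⟨by simpa using measure_closedBall_lt_top⟩
  have hint : ∀ f : Eucl n → ℝ, Continuous f → ∫ x, f x ∂ν = ∫ p in B, f (T p) := fun f hf =>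
    integral_map hT.aemeasurable hf.aestronglyMeasurable
  have hfrΩ : ∀ x ∈ frontier Ω, x ∉ Ω := fun x hx => by
    rw [ho.frontier_eq] at hx; exact hx.2
  have hsub : ∀ p, DifferentiableAt ℝ (legendre z) p → ∀ x ∈ Ω,
      IsSubgradient Ω u x p → p ∈ B ∧ T p = x := by
    intro p hp x hx hpx
    refine ⟨mem_closedBall_zero_iff.2 (norm_le_of_isSubgradient ho huL hx hpx), ?_⟩
    refine gradient_legendre_eq hz hp (x := ⟨x, subset_closure hx⟩)
      (le_antisymm (legendre_le fun y => ?_) (le_legendre hz p _))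
    have := hpx.closure huC.continuousOn y y.2
    rw [inner_sub_right] at this
    simp only [z]
    linarith
  have hsub' : ∀ p, DifferentiableAt ℝ (legendre z) p → IsSubgradient Ω u (T p) p := by
    intro p hp y hy
    obtain ⟨x, hx⟩ := exists_legendre_eq hz p
    have h1 : T p = x := gradient_legendre_eq hz hp hx
    have h2 := le_legendre hz p ⟨y, subset_closure hy⟩
    rw [hx] at h2
    rw [h1, inner_sub_right]
    simp only [z] at h2
    linarith
  -- At points of differentiability of the transform, hence almost everywhere, `p` is a slope of `u`
  -- over `A` exactly when `p ∈ B` and `T p ∈ A`. So `ν` is the Monge-Ampère measure of `u` inside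
  -- `Ω`.
  have hνA : ∀ A, MeasurableSet A → A ⊆ Ω → volume (subgradientImage Ω u A) = ν A := by
    intro A hA hAΩ
    rw [Measure.map_apply hT hA, Measure.restrict_apply (hT hA)]
    refine measure_congr ?_
    filter_upwards [ae_differentiableAt_legendre hz] with p hp
    refine propext ⟨?_, fun h => ⟨T p, h.1, hsub' p hp⟩⟩
    rintro ⟨x, hxA, hx⟩
    have := hsub p hp x (hAΩ hxA) hx
    exact ⟨by rw [mem_preimage, this.2]; exact hxA, this.1⟩
  -- Upward perturbations never violate the obstacle constraint.
  have hle : ∀ A, MeasurableSet A → A ⊆ Ω → ν A ≤ volume.restrict Ω A := by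
    intro A hA hAΩ
    refine measure_le_of_forall_integral_le ho (fun C hC hCΩ f hf h0 h1 hfC => ?_) hA hAΩ
    rw [hint f hf]
    refine integral_gradient_legendre_le hadm hmin hf
      (fun x hx => hfC x fun h => hfrΩ x hx (hCΩ h)) fun ε hε _ x => ?_
    exact (hadm.le x).trans (le_add_of_nonneg_right (mul_nonneg hε.le (h0 x)))
  set U := Ω ∩ {x | z₀ x < u x}
  have hUo : IsOpen U := by
    have h : ContinuousOn (fun x => u x - z₀ x) Ω :=
      huC.continuousOn.sub (hz₀.mono subset_closure)
    have := h.isOpen_inter_preimage ho (isOpen_Ioi (a := (0 : ℝ)))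
    convert this using 1
    ext x
    simp [U]
  -- Off the contact set there is a gap of at least `c` on the compact support, so the downward
  -- perturbation `-c f` is admissible as well.
  have hge : ∀ A, MeasurableSet A → A ⊆ U → volume.restrict Ω A ≤ ν A := by
    intro A hA hAU
    refine measure_le_of_forall_integral_le hUo (fun C hC hCU f hf h0 h1 hfC => ?_) hA hAU
    rw [hint f hf]
    obtain ⟨c, hc, hcC⟩ : ∃ c > 0, ∀ x ∈ C, c ≤ u x - z₀ x := by
      rcases C.eq_empty_or_nonempty with rfl | hne
      · exact ⟨1, one_pos, by simp⟩
      · obtain ⟨x, hx, hmin⟩ := hC.exists_isMinOn hne (f := fun x => u x - z₀ x)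
          (huC.continuousOn.sub (hz₀.mono ((hCU.trans inter_subset_left).trans subset_closure)))
        exact ⟨_, sub_pos.2 (hCU hx).2, fun y hy => hmin hy⟩
    have h := integral_gradient_legendre_le hadm hmin (f := fun x => -(c * f x)) (by fun_prop)
      (fun x hx => by simp [hfC x fun h => hfrΩ x hx (hCU h).1]) fun ε hε hε1 x => ?_
    · simp only [integral_neg, integral_const_mul, neg_le_neg_iff] at h
      exact le_of_mul_le_mul_left h hc
    · by_cases hx : (x : Eucl n) ∈ C
      · have h2 := hcC x hx
        have h3 : ε * (c * f x) ≤ 1 * (c * 1) := by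
          gcongr
          · exact mul_nonneg hc.le (h0 x)
          · exact h1 x
        simp only [z]
        linarith
      · simpa [hfC x hx] using hadm.le x
  -- At a contact point a supporting plane of `z₀` supports `u` too, so the lower volume bound for
  -- `F` passes to `u`.
  have hcontact : ∀ A, MeasurableSet A → A ⊆ Ω → (∀ x ∈ A, u x = z₀ x) →
      volume.restrict Ω A ≤ ν A := by
    intro A hA hAΩ hAc
    rw [Measure.restrict_eq_self _ hAΩ, ← hνA A hA hAΩ]
    refine (hvol A hA hAΩ).trans (measure_mono ?_)
    rintro _ ⟨x, hx, rfl⟩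
    refine ⟨x, hx, fun y hy => ?_⟩
    rw [hAc x hx]
    exact (hF x (hAΩ hx) y (subset_closure hy)).trans (hadm.le ⟨y, subset_closure hy⟩)
  refine ⟨u, huc.subset (subset_univ _) hconv.closure, huC.continuousOn, fun A hA hAΩ => ?_,
    fun x hx => hadm.eq_frontier ⟨x, frontier_subset_closure hx⟩ hx⟩
  have h1 : volume (subgradientImage Ω u A) = volume.restrict Ω A := by
    rw [hνA A hA hAΩ]
    refine le_antisymm (hle A hA hAΩ) ?_
    rw [← measure_inter_add_sdiff A hUo.measurableSet,
      ← measure_inter_add_sdiff (μ := ν) A hUo.measurableSet]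
    refine add_le_add (hge _ (hA.inter hUo.measurableSet) inter_subset_right)
      (hcontact _ (hA.diff hUo.measurableSet) (sdiff_subset.trans hAΩ) fun x hx => ?_)
    refine le_antisymm (not_lt.1 fun h => hx.2 ⟨hAΩ hx.1, h⟩)
      (hadm.le ⟨x, subset_closure (hAΩ hx.1)⟩)
  rw [h1, Measure.restrict_eq_self _ hAΩ]
  simp

/-- Comparison of an Alexandrov solution of `det D²u = 1` with a strict subsolution. -/
theorem IsDirichletSolution.le_of_subsolution {Ω : Set (Eucl n)} (ho : IsOpen Ω)
    (hb : Bornology.IsBounded Ω) {φ u w : Eucl n → ℝ} {F : Eucl n → Eucl n}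
    (hu : IsDirichletSolution Ω (fun _ => 1) φ u) (hw : ContinuousOn w (closure Ω))
    (hwφ : ∀ x ∈ frontier Ω, w x ≤ φ x)
    (hF : ∀ x ∈ Ω, IsSubgradient (closure Ω) w x (F x))
    (hvol : ∀ A : Set (Eucl n), MeasurableSet A → A ⊆ Ω → 2 * volume A ≤ volume (F '' A)) :
    ∀ x ∈ closure Ω, w x ≤ u x := by
  suffices h : ∀ x ∈ Ω, w x ≤ u x from fun x hx => le_on_closure h hw hu.continuousOn hx
  set D := Ω ∩ {x | u x < w x}
  have hDo : IsOpen D := by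
    have h : ContinuousOn (fun x => w x - u x) Ω :=
      (hw.sub hu.continuousOn).mono subset_closure
    have := h.isOpen_inter_preimage ho (isOpen_Ioi (a := (0 : ℝ)))
    convert this using 1
    ext x
    simp [D]
  have hDΩ : D ⊆ Ω := inter_subset_left
  -- Slide a plane of slope `F x` up to the graph of `u`. It cannot touch first where `w ≤ u`, since
  -- there the supporting plane of `w` at `x` lies below `u`, while at `x` it lies strictly above.
  have hsub : F '' D ⊆ subgradientImage Ω u D := by
    rintro _ ⟨x, hx, rfl⟩
    obtain ⟨y, hyK, hy⟩ := hb.isCompact_closure.exists_isMinOn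
      ⟨x, subset_closure (hDΩ hx)⟩ (f := fun y => u y - inner ℝ (F x) y)
      (hu.continuousOn.sub (by fun_prop))
    have hyD : y ∈ D := by
      by_contra hyD
      have h1 : w y ≤ u y := by
        by_cases hyΩ : y ∈ Ω
        · exact not_lt.1 fun h => hyD ⟨hyΩ, h⟩
        · have hyf : y ∈ frontier Ω := by rw [ho.frontier_eq]; exact ⟨hyK, hyΩ⟩
          rw [hu.eq_boundary y hyf]
          exact hwφ y hyf
      have h2 := hF x (hDΩ hx) y hyK
      have h3 : u y - inner ℝ (F x) y ≤ u x - inner ℝ (F x) x := hy (subset_closure (hDΩ hx))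
      have h4 : u x < w x := hx.2
      rw [inner_sub_right] at h2
      linarith
    refine ⟨y, hyD, fun v hv => ?_⟩
    have h3 : u y - inner ℝ (F x) y ≤ u v - inner ℝ (F x) v := hy (subset_closure hv)
    rw [inner_sub_right]
    linarith
  have h1 : volume (subgradientImage Ω u D) = volume D := by
    rw [hu.detHessian_eq D hDo.measurableSet hDΩ]; simp
  have h2 := (hvol D hDo.measurableSet hDΩ).trans (measure_mono hsub)
  rw [h1] at h2
  have hfin : volume D ≠ ⊤ := (hb.subset hDΩ).measure_lt_top.ne
  -- Now `2|D| ≤ |D| < ∞`; the factor `2` in the volume hypothesis is what makes this decisive.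
  have h0 : volume D = 0 := by
    by_contra hne
    have := ENNReal.toReal_mono hfin h2
    rw [ENNReal.toReal_mul] at this
    have hpos := ENNReal.toReal_pos hne hfin
    norm_num at this
    linarith
  intro x hx
  by_contra hlt
  have := (hDo.measure_eq_zero_iff volume).1 h0
  exact (this ▸ (⟨hx, not_le.1 hlt⟩ : x ∈ D) : x ∈ (∅ : Set (Eucl n)))

end

/-! ### Strict convexity, the area formula and rank two determinants. -/

section

variable {n : ℕ}

/-- A function with positive definite Hessian lies strictly above its tangent planes. -/
theorem lt_of_hessian_pos {Ω : Set (Eucl n)} (hconv : Convex ℝ Ω) {w : Eucl n → ℝ}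
    {F : Eucl n → Eucl n} {H : Eucl n → Eucl n →L[ℝ] Eucl n}
    (hw : ∀ x ∈ Ω, HasFDerivAt w (innerSL ℝ (F x)) x) (hF : ∀ x ∈ Ω, HasFDerivAt F (H x) x)
    (hH : ∀ x ∈ Ω, ∀ v, v ≠ 0 → 0 < inner ℝ (H x v) v) {x y : Eucl n} (hx : x ∈ Ω) (hy : y ∈ Ω)
    (hxy : x ≠ y) : w x + inner ℝ (F x) (y - x) < w y := by
  set v := y - x
  have hv : v ≠ 0 := sub_ne_zero.2 hxy.symm
  have hmem : ∀ t ∈ Icc (0 : ℝ) 1, x + t • v ∈ Ω := fun t ht =>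
    hconv.add_smul_sub_mem hx hy ht
  have hline : ∀ t, HasDerivAt (fun t : ℝ => x + t • v) v t := fun t => by
    simpa using ((hasDerivAt_id t).smul_const v).const_add x
  have h1 : ∀ t ∈ Icc (0 : ℝ) 1,
      HasDerivAt (fun t : ℝ => w (x + t • v)) (inner ℝ (F (x + t • v)) v) t := fun t ht => by
    have := (hw _ (hmem t ht)).comp_hasDerivAt t (hline t)
    rwa [innerSL_apply_apply] at this
  have h2 : ∀ t ∈ Icc (0 : ℝ) 1, HasDerivAt (fun t : ℝ => inner ℝ (F (x + t • v)) v)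
      (inner ℝ (H (x + t • v) v) v) t := fun t ht => by
    have := ((hF _ (hmem t ht)).comp_hasDerivAt t (hline t)).inner ℝ (hasDerivAt_const t v)
    simpa using this
  have hmono : StrictMonoOn (fun t : ℝ => inner ℝ (F (x + t • v)) v) (Icc 0 1) := by
    refine strictMonoOn_of_deriv_pos (convex_Icc 0 1)
      (fun t ht => (h2 t ht).continuousAt.continuousWithinAt) fun t ht => ?_
    rw [interior_Icc] at ht
    rw [(h2 t (Ioo_subset_Icc_self ht)).deriv]
    exact hH _ (hmem t (Ioo_subset_Icc_self ht)) v hv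
  obtain ⟨τ, hτ, h3⟩ := exists_hasDerivAt_eq_slope (fun t : ℝ => w (x + t • v))
    (fun t => inner ℝ (F (x + t • v)) v) one_pos
    (fun t ht => (h1 t ht).continuousAt.continuousWithinAt)
    (fun t ht => h1 t (Ioo_subset_Icc_self ht))
  have h4 := hmono (left_mem_Icc.2 zero_le_one) (Ioo_subset_Icc_self hτ) hτ.1
  have h5 : x + v = y := by simp [v]
  simp only [zero_smul, add_zero, one_smul, sub_zero, div_one, h5] at h3 h4
  linarith

/-- If two points shared a slope, adding the two strict inequalities would give a contradiction. -/
theorem injOn_of_lt_of_ne {Ω : Set (Eucl n)} {w : Eucl n → ℝ} {F : Eucl n → Eucl n}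
    (h : ∀ x ∈ Ω, ∀ y ∈ Ω, x ≠ y → w x + inner ℝ (F x) (y - x) < w y) : InjOn F Ω := by
  intro x hx y hy hxy
  by_contra hne
  have h1 := h x hx y hy hne
  have h2 := h y hy x hx (Ne.symm hne)
  rw [hxy] at h1
  rw [inner_sub_right] at h1 h2
  linarith

theorem mul_volume_le_volume_image {A : Set (Eucl n)} (hA : MeasurableSet A)
    {F : Eucl n → Eucl n} {H : Eucl n → Eucl n →L[ℝ] Eucl n}
    (hF : ∀ x ∈ A, HasFDerivAt F (H x) x) (hinj : InjOn F A) {c : NNReal}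
    (hdet : ∀ x ∈ A, c ≤ (H x).det) : c * volume A ≤ volume (F '' A) := by
  rw [← lintegral_abs_det_fderiv_eq_addHaar_image volume hA
    (fun x hx => (hF x hx).hasFDerivWithinAt) hinj, ← setLIntegral_const]
  refine setLIntegral_mono' hA fun x hx => ?_
  rw [← ENNReal.ofReal_coe_nnreal]
  exact ENNReal.ofReal_le_ofReal ((hdet x hx).trans (le_abs_self _))

/-- The determinant of a rank two perturbation of a multiple of the identity. -/
theorem det_smul_id_add_add {α : ℝ} (hα : α ≠ 0) (a b c e : Eucl n) :
    (α • ContinuousLinearMap.id ℝ (Eucl n) + (innerSL ℝ a).smulRight b +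
      (innerSL ℝ c).smulRight e).det =
    α ^ n * ((1 + inner ℝ a b / α) * (1 + inner ℝ c e / α) -
      inner ℝ a e / α * (inner ℝ c b / α)) := by
  -- The operator is `α (1 + A B)`, and `det (1 + A B) = det (1 + B A)` reduces the computation to a
  -- `2 × 2` determinant.
  let A : Matrix (Fin n) (Fin 2) ℝ := Matrix.of fun i => ![b i, e i]
  let B : Matrix (Fin 2) (Fin n) ℝ := Matrix.of ![fun j => a j / α, fun j => c j / α]
  have h : LinearMap.toMatrix (EuclideanSpace.basisFun (Fin n) ℝ).toBasis
      (EuclideanSpace.basisFun (Fin n) ℝ).toBasis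
      (α • ContinuousLinearMap.id ℝ (Eucl n) + (innerSL ℝ a).smulRight b +
        (innerSL ℝ c).smulRight e : Eucl n →L[ℝ] Eucl n).toLinearMap = α • (1 + A * B) := by
    ext i j
    simp [LinearMap.toMatrix_apply, A, B, Matrix.mul_apply, Fin.sum_univ_two, Matrix.one_apply,
      EuclideanSpace.inner_single_right]
    split_ifs <;> field_simp <;> ring
  rw [ContinuousLinearMap.det, ← LinearMap.det_toMatrix (EuclideanSpace.basisFun (Fin n) ℝ).toBasis,
    h, Matrix.det_smul, Matrix.det_one_add_mul_comm, Matrix.det_fin_two, Fintype.card_fin]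
  have hin : ∀ v w : Eucl n, ∑ j, v j / α * w j = inner ℝ v w / α := fun v w => by
    rw [PiLp.inner_apply, Finset.sum_div]
    exact Finset.sum_congr rfl fun j _ => by simp; ring
  have hBA : B * A = Matrix.of ![![inner ℝ a b / α, inner ℝ a e / α],
      ![inner ℝ c b / α, inner ℝ c e / α]] := by
    ext i j
    rw [Matrix.mul_apply]
    fin_cases i <;> fin_cases j <;> exact hin _ _
  simp [hBA]

/-! ### The logarithmic barrier on the tangent ball. -/

section Barrier

variable {d : ℕ} {ρ : ℝ} {x : Eucl (d + 1)}

theorem inner_lastVec (x : Eucl (d + 1)) : inner ℝ (lastVec d) x = x (Fin.last d) := by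
  simp [lastVec, EuclideanSpace.inner_single_left]

theorem norm_lastVec : ‖lastVec d‖ = 1 := by simp [lastVec]

theorem lastVec_last : lastVec d (Fin.last d) = 1 := by simp [lastVec]

theorem norm_sub_sq_lastVec (ρ : ℝ) (x : Eucl (d + 1)) :
    ‖x - ρ • lastVec d‖ ^ 2 = ‖x‖ ^ 2 - 2 * ρ * x (Fin.last d) + ρ ^ 2 := by
  rw [norm_sub_sq_real, real_inner_smul_right, real_inner_comm, inner_lastVec, norm_smul,
    norm_lastVec, Real.norm_eq_abs, mul_one, sq_abs]
  ring

theorem mem_tangentBall (hρ : 0 < ρ) :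
    x ∈ tangentBall d ρ ↔ ‖x‖ ^ 2 < 2 * ρ * x (Fin.last d) := by
  rw [tangentBall, Metric.mem_ball, dist_eq_norm, ← sq_lt_sq₀ (norm_nonneg _) hρ.le,
    norm_sub_sq_lastVec]
  constructor <;> intro h <;> linarith

theorem mem_closure_tangentBall (hρ : 0 < ρ) :
    x ∈ closure (tangentBall d ρ) ↔ ‖x‖ ^ 2 ≤ 2 * ρ * x (Fin.last d) := by
  rw [tangentBall, closure_ball _ hρ.ne', Metric.mem_closedBall, dist_eq_norm,
    ← sq_le_sq₀ (norm_nonneg _) hρ.le, norm_sub_sq_lastVec]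
  constructor <;> intro h <;> linarith

theorem mem_frontier_tangentBall (hρ : 0 < ρ) :
    x ∈ frontier (tangentBall d ρ) ↔ ‖x‖ ^ 2 = 2 * ρ * x (Fin.last d) := by
  rw [tangentBall, frontier_ball _ hρ.ne', Metric.mem_sphere, dist_eq_norm,
    ← sq_eq_sq₀ (norm_nonneg _) hρ.le, norm_sub_sq_lastVec]
  constructor <;> intro h <;> linarith

theorem sq_last_le_norm_sq (x : Eucl (d + 1)) : x (Fin.last d) ^ 2 ≤ ‖x‖ ^ 2 := by
  rw [EuclideanSpace.real_norm_sq_eq]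
  exact Finset.single_le_sum (f := fun i => x i ^ 2) (fun i _ => sq_nonneg _) (Finset.mem_univ _)

theorem last_nonneg_of_mem_closure (hρ : 0 < ρ) (hx : x ∈ closure (tangentBall d ρ)) :
    0 ≤ x (Fin.last d) := by
  rw [mem_closure_tangentBall hρ] at hx
  nlinarith [sq_nonneg ‖x‖]

theorem last_le_of_mem_closure (hρ : 0 < ρ) (hx : x ∈ closure (tangentBall d ρ)) :
    x (Fin.last d) ≤ 2 * ρ := by
  have h := last_nonneg_of_mem_closure hρ hx
  rw [mem_closure_tangentBall hρ] at hx
  nlinarith [sq_last_le_norm_sq x]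

theorem last_pos_of_mem (hρ : 0 < ρ) (hx : x ∈ tangentBall d ρ) : 0 < x (Fin.last d) := by
  rw [mem_tangentBall hρ] at hx
  nlinarith [sq_nonneg ‖x‖]

/-- The radii for which the barrier is a strict subsolution. -/
structure IsSmallRadius (d : ℕ) (ρ : ℝ) : Prop where
  pos : 0 < ρ
  le_half : ρ ≤ 1 / 2
  one_le : ∀ s : ℝ, 0 < s → s ≤ 2 * ρ → 1 ≤ -Real.log s
  mul_pow_le : ∀ s : ℝ, 0 < s → s ≤ 2 * ρ → 2 * (s * (-Real.log s) ^ (d + 3)) ≤ 1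

/-- Powers of `|log s|` are negligible against `s⁻¹` as `s → 0`. -/
theorem exists_isSmallRadius (d : ℕ) :
    ∃ ρ₀ : ℝ, 0 < ρ₀ ∧ ρ₀ ≤ 1 / 2 ∧ ∀ ρ, 0 < ρ → ρ < ρ₀ → IsSmallRadius d ρ := by
  have h1 : ∀ᶠ s in 𝓝[>] (0 : ℝ), Real.log s ≤ -1 :=
    Real.tendsto_log_nhdsGT_zero.eventually_le_atBot (-1)
  have h2 : ∀ᶠ s in 𝓝[>] (0 : ℝ), ‖|Real.log s| ^ ((d + 3 : ℕ) : ℝ)‖ ≤ 1 / 2 * ‖s ^ (-1 : ℝ)‖ :=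
    (isLittleO_abs_log_rpow_rpow_nhdsGT_zero ((d + 3 : ℕ) : ℝ) (by norm_num)).def (by norm_num)
  obtain ⟨r, hr, h⟩ := mem_nhdsGT_iff_exists_Ioo_subset.1 (h1.and h2)
  have hr : 0 < r := hr
  refine ⟨min (1 / 2) (r / 2), by positivity, min_le_left _ _, fun ρ hρ hρr => ?_⟩
  have hρ1 := hρr.trans_le (min_le_left _ _)
  have hρ2 := hρr.trans_le (min_le_right _ _)
  have hs : ∀ s, 0 < s → s ≤ 2 * ρ → _ := fun s hs0 hs => h ⟨hs0, by linarith⟩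
  refine ⟨hρ, hρ1.le, fun s hs0 hs1 => by linarith [(hs s hs0 hs1).1], fun s hs0 hs1 => ?_⟩
  have h3 := (hs s hs0 hs1).2
  rw [Real.rpow_natCast, abs_of_neg (by linarith [(hs s hs0 hs1).1]), Real.rpow_neg_one,
    Real.norm_of_nonneg (pow_nonneg (by linarith [(hs s hs0 hs1).1]) _),
    Real.norm_of_nonneg (inv_nonneg.2 hs0.le)] at h3
  have h4 := mul_le_mul_of_nonneg_left h3 hs0.le
  have h5 : s * (1 / 2 * s⁻¹) = 1 / 2 := by field_simp
  linarith

/-- The function `s ↦ 1 / (-log s)`. -/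
def invLog (s : ℝ) : ℝ := (-Real.log s)⁻¹

/-- The derivative of `invLog`. -/
def invLog₁ (s : ℝ) : ℝ := (s * (-Real.log s) ^ 2)⁻¹

/-- The second derivative of `invLog`. -/
def invLog₂ (s : ℝ) : ℝ := (2 / (-Real.log s) - 1) / (s ^ 2 * (-Real.log s) ^ 2)

theorem hasDerivAt_invLog {s : ℝ} (hs : 0 < s) (hL : 0 < -Real.log s) :
    HasDerivAt invLog (invLog₁ s) s := by
  refine ((Real.hasDerivAt_log hs.ne').neg.inv hL.ne').congr_deriv ?_
  rw [invLog₁, neg_neg, mul_inv, div_eq_mul_inv]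
  rfl

theorem hasDerivAt_invLog₁ {s : ℝ} (hs : 0 < s) (hL : 0 < -Real.log s) :
    HasDerivAt invLog₁ (invLog₂ s) s := by
  have h0 : Real.log s ≠ 0 := by linarith
  have h := ((hasDerivAt_id s).mul ((Real.hasDerivAt_log hs.ne').neg.pow 2)).inv
    (by simp [hs.ne', h0])
  refine h.congr_deriv ?_
  simp only [invLog₂, id, Pi.mul_apply, Pi.pow_apply, Pi.neg_apply]
  field_simp
  ring

/-- The quadratic function `x_n / 2 + |x|² / (4ρ)`, equal to `x_n` on the sphere. -/
def quadWeight (d : ℕ) (ρ : ℝ) (x : Eucl (d + 1)) : ℝ := x (Fin.last d) / 2 + ‖x‖ ^ 2 / (4 * ρ)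

/-- The gradient of `quadWeight`. -/
def quadWeightGrad (d : ℕ) (ρ : ℝ) (x : Eucl (d + 1)) : Eucl (d + 1) :=
  (1 / 2 : ℝ) • lastVec d + (1 / (2 * ρ)) • x

/-- The subsolution `(x_n / 2 + |x|² / (4ρ)) / (-log x_n)`. -/
def barrier (d : ℕ) (ρ : ℝ) (x : Eucl (d + 1)) : ℝ :=
  invLog (x (Fin.last d)) * quadWeight d ρ x

/-- The gradient of the barrier. -/
def barrierGrad (d : ℕ) (ρ : ℝ) (x : Eucl (d + 1)) : Eucl (d + 1) :=
  invLog (x (Fin.last d)) • quadWeightGrad d ρ x +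
    (invLog₁ (x (Fin.last d)) * quadWeight d ρ x) • lastVec d

/-- The Hessian of the barrier. -/
def barrierHess (d : ℕ) (ρ : ℝ) (x : Eucl (d + 1)) : Eucl (d + 1) →L[ℝ] Eucl (d + 1) :=
  (invLog (x (Fin.last d)) / (2 * ρ)) • ContinuousLinearMap.id ℝ (Eucl (d + 1)) +
    (innerSL ℝ (lastVec d)).smulRight (invLog₁ (x (Fin.last d)) • quadWeightGrad d ρ x +
      (invLog₂ (x (Fin.last d)) * quadWeight d ρ x) • lastVec d) +
    (innerSL ℝ (quadWeightGrad d ρ x)).smulRight (invLog₁ (x (Fin.last d)) • lastVec d)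

theorem hasFDerivAt_last (x : Eucl (d + 1)) :
    HasFDerivAt (fun x : Eucl (d + 1) => x (Fin.last d)) (innerSL ℝ (lastVec d)) x := by
  refine (innerSL ℝ (lastVec d)).hasFDerivAt.congr_of_eventuallyEq
    (Eventually.of_forall fun y => ?_)
  simp [inner_lastVec]

theorem hasFDerivAt_quadWeight (x : Eucl (d + 1)) :
    HasFDerivAt (quadWeight d ρ) (innerSL ℝ (quadWeightGrad d ρ x)) x := by
  have h := ((hasFDerivAt_last x).mul_const (1 / 2)).add
    ((hasStrictFDerivAt_norm_sq x).hasFDerivAt.mul_const (1 / (4 * ρ)))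
  refine (h.congr_fderiv ?_).congr_of_eventuallyEq (Eventually.of_forall fun y => ?_)
  · ext v
    simp [quadWeightGrad]
    ring
  · simp [quadWeight]
    ring

theorem hasFDerivAt_quadWeightGrad (x : Eucl (d + 1)) :
    HasFDerivAt (quadWeightGrad d ρ) ((1 / (2 * ρ)) • ContinuousLinearMap.id ℝ (Eucl (d + 1))) x :=
  ((hasFDerivAt_id x).const_smul (1 / (2 * ρ))).const_add ((1 / 2 : ℝ) • lastVec d)

theorem hasFDerivAt_barrier (hs : 0 < x (Fin.last d)) (hL : 0 < -Real.log (x (Fin.last d))) :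
    HasFDerivAt (barrier d ρ) (innerSL ℝ (barrierGrad d ρ x)) x := by
  have h := ((hasDerivAt_invLog hs hL).comp_hasFDerivAt x (hasFDerivAt_last x)).mul
    (hasFDerivAt_quadWeight (ρ := ρ) x)
  refine h.congr_fderiv ?_
  ext v
  simp [barrierGrad]
  ring

theorem hasFDerivAt_barrierGrad (hs : 0 < x (Fin.last d)) (hL : 0 < -Real.log (x (Fin.last d))) :
    HasFDerivAt (barrierGrad d ρ) (barrierHess d ρ x) x := by
  have h1 := ((hasDerivAt_invLog hs hL).comp_hasFDerivAt x (hasFDerivAt_last x)).smul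
    (hasFDerivAt_quadWeightGrad (ρ := ρ) x)
  have h2 := (((hasDerivAt_invLog₁ hs hL).comp_hasFDerivAt x (hasFDerivAt_last x)).mul
    (hasFDerivAt_quadWeight (ρ := ρ) x)).smul_const (lastVec d)
  refine (h1.add h2).congr_fderiv ?_
  ext v i
  simp [barrierHess]
  ring

/-- The determinant of the Hessian of the barrier in the plane spanned by `e_n` and the
tangential direction of `x`. -/
def barrierMinor (d : ℕ) (ρ : ℝ) (x : Eucl (d + 1)) : ℝ :=
  invLog (x (Fin.last d)) / (2 * ρ) * (invLog (x (Fin.last d)) / (2 * ρ) +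
    2 * invLog₁ (x (Fin.last d)) * (1 / 2 + x (Fin.last d) / (2 * ρ)) +
    invLog₂ (x (Fin.last d)) * quadWeight d ρ x) -
  invLog₁ (x (Fin.last d)) ^ 2 * ((‖x‖ ^ 2 - x (Fin.last d) ^ 2) / (4 * ρ ^ 2))

theorem le_barrierMinor (hρ : 0 < ρ) (hx : x ∈ tangentBall d ρ)
    (hL : 0 < -Real.log (x (Fin.last d))) :
    1 / (2 * ρ * x (Fin.last d) * (-Real.log (x (Fin.last d))) ^ 4) ≤ barrierMinor d ρ x := by
  have hs := last_pos_of_mem hρ hx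
  rw [mem_tangentBall hρ] at hx
  unfold barrierMinor quadWeight invLog invLog₁ invLog₂
  set s := x (Fin.last d)
  set L := -Real.log s
  set P := ‖x‖ ^ 2
  -- The terms in `P / L⁴` cancel. The order `L⁻³` contributes `2ρs - P`, which is positive exactly
  -- inside the ball, and the order `L⁻⁴` produces the claimed bound.
  have h : L⁻¹ / (2 * ρ) * (L⁻¹ / (2 * ρ) + 2 * (s * L ^ 2)⁻¹ * (1 / 2 + s / (2 * ρ)) +
      (2 / L - 1) / (s ^ 2 * L ^ 2) * (s / 2 + P / (4 * ρ))) -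
      (s * L ^ 2)⁻¹ ^ 2 * ((P - s ^ 2) / (4 * ρ ^ 2)) - 1 / (2 * ρ * s * L ^ 4) =
      1 / (4 * ρ ^ 2 * L ^ 2) + 1 / (2 * ρ ^ 2 * L ^ 3) +
      (2 * ρ * s - P) / (8 * ρ ^ 2 * s ^ 2 * L ^ 3) + 1 / (4 * ρ ^ 2 * L ^ 4) := by
    field_simp
    ring
  have h2 : 0 < 2 * ρ * s - P := sub_pos.2 hx
  rw [← sub_nonneg, h]
  positivity

theorem inner_lastVec_quadWeightGrad (x : Eucl (d + 1)) :
    inner ℝ (lastVec d) (quadWeightGrad d ρ x) = 1 / 2 + x (Fin.last d) / (2 * ρ) := by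
  rw [quadWeightGrad, inner_add_right, real_inner_smul_right, real_inner_smul_right,
    real_inner_self_eq_norm_sq, norm_lastVec, inner_lastVec]
  ring

theorem inner_barrierHess_pos (hρ : 0 < ρ) (hx : x ∈ tangentBall d ρ)
    (hL : 0 < -Real.log (x (Fin.last d))) {v : Eucl (d + 1)} (hv : v ≠ 0) :
    0 < inner ℝ (barrierHess d ρ x v) v := by
  have hs := last_pos_of_mem hρ hx
  have hΔ : 0 < barrierMinor d ρ x :=
    lt_of_lt_of_le (by positivity) (le_barrierMinor hρ hx hL)
  set α := invLog (x (Fin.last d)) / (2 * ρ)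
  have hα : 0 < α := by
    have : 0 < invLog (x (Fin.last d)) := inv_pos.2 hL
    positivity
  set y := x - x (Fin.last d) • lastVec d
  set w := v - v (Fin.last d) • lastVec d
  have hyy : inner ℝ y y = ‖x‖ ^ 2 - x (Fin.last d) ^ 2 := by
    simp only [y, inner_sub_left, inner_sub_right, real_inner_smul_left, real_inner_smul_right,
      inner_lastVec, lastVec_last, real_inner_comm (lastVec d) x]
    rw [real_inner_self_eq_norm_sq]
    ring
  have hwy : inner ℝ w y = inner ℝ x v - x (Fin.last d) * v (Fin.last d) := by
    simp only [y, w, inner_sub_left, inner_sub_right, real_inner_smul_left, real_inner_smul_right,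
      inner_lastVec, lastVec_last, real_inner_comm (lastVec d) v,
      real_inner_comm x v]
    ring
  have hww : inner ℝ w w = ‖v‖ ^ 2 - v (Fin.last d) ^ 2 := by
    simp only [w, inner_sub_left, inner_sub_right, real_inner_smul_left, real_inner_smul_right,
      inner_lastVec, lastVec_last, real_inner_comm (lastVec d) v]
    rw [real_inner_self_eq_norm_sq]
    ring
  -- Completing the square in the part `w` of `v` orthogonal to `e_n`; the Schur complement left
  -- over is `barrierMinor`.
  have key : α * inner ℝ (barrierHess d ρ x v) v =
      ‖α • w + (invLog₁ (x (Fin.last d)) * v (Fin.last d) / (2 * ρ)) • y‖ ^ 2 +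
        barrierMinor d ρ x * v (Fin.last d) ^ 2 := by
    rw [← real_inner_self_eq_norm_sq]
    simp only [inner_add_left, inner_add_right, real_inner_smul_left, real_inner_smul_right,
      real_inner_comm w y, hyy, hwy, hww, barrierHess, add_apply, smul_apply,
      ContinuousLinearMap.smulRight_apply, ContinuousLinearMap.id_apply, innerSL_apply_apply,
      inner_lastVec, quadWeightGrad, barrierMinor]
    rw [real_inner_self_eq_norm_sq]
    simp only [α]
    field_simp
    ring
  refine pos_of_mul_pos_right (a := α) ?_ hα.le
  rw [key]
  by_cases h0 : v (Fin.last d) = 0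
  · have : w = v := by simp [w, h0]
    rw [h0, this]
    have : 0 < ‖α • v‖ := norm_pos_iff.2 (smul_ne_zero hα.ne' hv)
    rw [mul_zero, zero_div, zero_smul, add_zero, sq (0 : ℝ), mul_zero, mul_zero, add_zero]
    positivity
  · positivity

theorem det_barrierHess (hx : invLog (x (Fin.last d)) / (2 * ρ) ≠ 0) :
    (barrierHess d ρ x).det =
      (invLog (x (Fin.last d)) / (2 * ρ)) ^ (d + 1) / (invLog (x (Fin.last d)) / (2 * ρ)) ^ 2 *
        barrierMinor d ρ x := by
  rw [barrierHess, det_smul_id_add_add hx]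
  have hqq : inner ℝ (quadWeightGrad d ρ x) (quadWeightGrad d ρ x) =
      (1 / 2 + x (Fin.last d) / (2 * ρ)) ^ 2 +
        (‖x‖ ^ 2 - x (Fin.last d) ^ 2) / (4 * ρ ^ 2) := by
    simp only [quadWeightGrad, inner_add_left, inner_add_right, real_inner_smul_left,
      real_inner_smul_right, inner_lastVec, lastVec_last, real_inner_comm (lastVec d) x]
    rw [real_inner_self_eq_norm_sq]
    ring
  simp only [inner_add_right, real_inner_smul_right, hqq, inner_lastVec_quadWeightGrad,
    real_inner_comm (lastVec d) (quadWeightGrad d ρ x), real_inner_self_eq_norm_sq, norm_lastVec]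
  rw [barrierMinor]
  set α := invLog (x (Fin.last d)) / (2 * ρ)
  field_simp
  ring

/-- With `s = x_n`, `L = -log s` and `2ρ ≤ 1`, the `d - 1` remaining eigenvalues are at least `1/L`
and the minor is at least `1/(s L⁴)`. The product `1/(s L^(d+3))` explains the exponent in
`IsSmallRadius`. -/
theorem IsSmallRadius.two_le_det_barrierHess (hd : 1 ≤ d) (hρ : IsSmallRadius d ρ)
    (hx : x ∈ tangentBall d ρ) : 2 ≤ (barrierHess d ρ x).det := by
  have hs := last_pos_of_mem hρ.pos hx
  have hs2 := last_le_of_mem_closure hρ.pos (subset_closure hx)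
  have hL := hρ.one_le _ hs hs2
  have hsm := hρ.mul_pow_le _ hs hs2
  have hΔ := le_barrierMinor hρ.pos hx (by linarith)
  have hρ0 := hρ.pos
  have hρ1 := hρ.le_half
  have hα : 0 < invLog (x (Fin.last d)) / (2 * ρ) := by
    have : 0 < invLog (x (Fin.last d)) := inv_pos.2 (by linarith)
    positivity
  rw [det_barrierHess hα.ne']
  set s := x (Fin.last d)
  have hαL : (-Real.log s)⁻¹ ≤ invLog s / (2 * ρ) := by
    rw [le_div_iff₀ (by positivity)]
    exact mul_le_of_le_one_right (inv_nonneg.2 (by linarith)) (by linarith)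
  set α := invLog s / (2 * ρ)
  set L := -Real.log s
  have hL0 : 0 < L := by linarith
  obtain ⟨k, rfl⟩ := Nat.exists_eq_add_of_le' hd
  have h1 : α ^ (k + 1 + 1) / α ^ 2 = α ^ k := by
    rw [show k + 1 + 1 = k + 2 by ring, pow_add]
    field_simp
  have h2 : 1 / (s * L ^ 4) ≤ 1 / (2 * ρ * s * L ^ 4) := by
    refine one_div_le_one_div_of_le (by positivity) ?_
    rw [mul_assoc (2 * ρ)]
    exact mul_le_of_le_one_left (by positivity) (by linarith)
  calc (2 : ℝ) ≤ 1 / (s * L ^ (k + 1 + 3)) := by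
        rw [le_div_iff₀ (by positivity)]; exact hsm
    _ = L⁻¹ ^ k * (1 / (s * L ^ 4)) := by
        rw [inv_pow, show k + 1 + 3 = k + 4 by ring, pow_add]
        field_simp
    _ ≤ α ^ (k + 1 + 1) / α ^ 2 * barrierMinor (k + 1) ρ x := by
        rw [h1]
        exact mul_le_mul (pow_le_pow_left₀ (by positivity) hαL k) (h2.trans hΔ) (by positivity)
          (by positivity)

theorem quadWeight_nonneg (hρ : 0 < ρ) (hx : x ∈ closure (tangentBall d ρ)) :
    0 ≤ quadWeight d ρ x := by
  have := last_nonneg_of_mem_closure hρ hx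
  unfold quadWeight
  positivity

theorem quadWeight_le (hρ : 0 < ρ) (hx : x ∈ closure (tangentBall d ρ)) :
    quadWeight d ρ x ≤ x (Fin.last d) := by
  rw [mem_closure_tangentBall hρ] at hx
  have h : ‖x‖ ^ 2 / (4 * ρ) ≤ x (Fin.last d) / 2 := by
    rw [div_le_iff₀ (by positivity)]; linarith
  unfold quadWeight
  linarith

theorem norm_le_of_mem_closure (hρ : 0 < ρ) (hx : x ∈ closure (tangentBall d ρ)) :
    ‖x‖ ≤ 2 * ρ := by
  have h1 := last_le_of_mem_closure hρ hx
  rw [mem_closure_tangentBall hρ] at hx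
  refine abs_le_of_sq_le_sq' ?_ (by positivity) |>.2
  nlinarith

theorem IsSmallRadius.norm_barrierGrad_le (hρ : IsSmallRadius d ρ) (hx : x ∈ tangentBall d ρ) :
    ‖barrierGrad d ρ x‖ ≤ 3 := by
  have hρ0 := hρ.pos
  have hxc := subset_closure hx
  have hs := last_pos_of_mem hρ.pos hx
  have hL := hρ.one_le _ hs (last_le_of_mem_closure hρ.pos hxc)
  have hq : ‖quadWeightGrad d ρ x‖ ≤ 3 / 2 := by
    refine (norm_add_le _ _).trans ?_
    rw [norm_smul, norm_smul, norm_lastVec, Real.norm_of_nonneg (by positivity),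
      Real.norm_of_nonneg (by positivity)]
    have : 1 / (2 * ρ) * ‖x‖ ≤ 1 := by
      rw [one_div, inv_mul_le_iff₀ (by positivity), mul_one]
      exact norm_le_of_mem_closure hρ0 hxc
    linarith
  have hm : 0 ≤ invLog (x (Fin.last d)) := inv_nonneg.2 (by linarith)
  have hm1 : invLog (x (Fin.last d)) ≤ 1 := inv_le_one_of_one_le₀ hL
  have hm2 : invLog₁ (x (Fin.last d)) * quadWeight d ρ x ≤ 1 := by
    rw [invLog₁, inv_mul_le_iff₀ (by positivity), mul_one]
    refine (quadWeight_le hρ0 hxc).trans (le_mul_of_one_le_right hs.le (one_le_pow₀ hL))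
  have hm3 : 0 ≤ invLog₁ (x (Fin.last d)) * quadWeight d ρ x :=
    mul_nonneg (inv_nonneg.2 (by positivity)) (quadWeight_nonneg hρ0 hxc)
  refine (norm_add_le _ _).trans ?_
  rw [norm_smul, norm_smul, norm_lastVec, Real.norm_of_nonneg hm, Real.norm_of_nonneg hm3]
  nlinarith [norm_nonneg (quadWeightGrad d ρ x)]

theorem IsSmallRadius.invLog_nonneg (hρ : IsSmallRadius d ρ)
    (hx : x ∈ closure (tangentBall d ρ)) : 0 ≤ invLog (x (Fin.last d)) := by
  rcases (last_nonneg_of_mem_closure hρ.pos hx).eq_or_lt with h | h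
  · simp [invLog, ← h]
  · exact inv_nonneg.2 (by linarith [hρ.one_le _ h (last_le_of_mem_closure hρ.pos hx)])

theorem IsSmallRadius.barrier_nonneg (hρ : IsSmallRadius d ρ)
    (hx : x ∈ closure (tangentBall d ρ)) : 0 ≤ barrier d ρ x :=
  mul_nonneg (hρ.invLog_nonneg hx) (quadWeight_nonneg hρ.pos hx)

theorem barrier_eq_logData (hρ : 0 < ρ) (hx : x ∈ frontier (tangentBall d ρ)) :
    barrier d ρ x = logData d x := by
  rw [mem_frontier_tangentBall hρ] at hx
  rw [barrier, logData, quadWeight, hx, invLog, div_eq_mul_inv (x (Fin.last d)) (-_)]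
  field_simp
  ring

/-- The origin is the only point of the closed ball with `x_n = 0`, and there the bounds `0 ≤
barrier ≤ x_n` give continuity. -/
theorem IsSmallRadius.continuousOn_barrier (hρ : IsSmallRadius d ρ) :
    ContinuousOn (barrier d ρ) (closure (tangentBall d ρ)) := by
  intro x hx
  have hρ0 := hρ.pos
  rcases (last_nonneg_of_mem_closure hρ0 hx).eq_or_lt with h | h
  · have hx0 : x = 0 := by
      rw [mem_closure_tangentBall hρ0, ← h, mul_zero] at hx
      exact norm_eq_zero.1 (pow_eq_zero_iff two_ne_zero |>.1 (le_antisymm hx (sq_nonneg _)))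
    have hb0 : barrier d ρ x = 0 := by simp [barrier, invLog, ← h]
    rw [ContinuousWithinAt, hb0]
    refine squeeze_zero' (g := fun y : Eucl (d + 1) => y (Fin.last d))
      (eventually_mem_nhdsWithin.mono fun y hy => hρ.barrier_nonneg hy)
      (eventually_mem_nhdsWithin.mono fun y hy => ?_) ?_
    · refine (mul_le_of_le_one_left (quadWeight_nonneg hρ0 hy) ?_).trans (quadWeight_le hρ0 hy)
      rcases (last_nonneg_of_mem_closure hρ0 hy).eq_or_lt with h | h
      · simp [invLog, ← h]
      · exact inv_le_one_of_one_le₀ (hρ.one_le _ h (last_le_of_mem_closure hρ0 hy))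
    · have := (hasFDerivAt_last x).continuousAt.continuousWithinAt (s := closure (tangentBall d ρ))
      rwa [ContinuousWithinAt, ← h] at this
  · have hL := hρ.one_le _ h (last_le_of_mem_closure hρ0 hx)
    exact (hasFDerivAt_barrier h (by linarith)).continuousAt.continuousWithinAt

theorem IsSmallRadius.barrier_lt (hρ : IsSmallRadius d ρ) {x y : Eucl (d + 1)}
    (hx : x ∈ tangentBall d ρ) (hy : y ∈ tangentBall d ρ) (hxy : x ≠ y) :
    barrier d ρ x + inner ℝ (barrierGrad d ρ x) (y - x) < barrier d ρ y := by
  have hL : ∀ z ∈ tangentBall d ρ, 0 < z (Fin.last d) ∧ 0 < -Real.log (z (Fin.last d)) :=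
    fun z hz => by
      have h := last_pos_of_mem hρ.pos hz
      exact ⟨h, by linarith [hρ.one_le _ h (last_le_of_mem_closure hρ.pos (subset_closure hz))]⟩
  exact lt_of_hessian_pos (convex_ball _ _)
    (fun z hz => hasFDerivAt_barrier (hL z hz).1 (hL z hz).2)
    (fun z hz => hasFDerivAt_barrierGrad (hL z hz).1 (hL z hz).2)
    (fun z hz v hv => inner_barrierHess_pos hρ.pos hz (hL z hz).2 hv) hx hy hxy

theorem IsSmallRadius.isSubgradient_barrier (hρ : IsSmallRadius d ρ) (hx : x ∈ tangentBall d ρ) :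
    IsSubgradient (closure (tangentBall d ρ)) (barrier d ρ) x (barrierGrad d ρ x) := by
  refine IsSubgradient.closure hρ.continuousOn_barrier fun y hy => ?_
  by_cases hxy : x = y
  · simp [hxy]
  · exact (hρ.barrier_lt hx hy hxy).le

theorem IsSmallRadius.two_mul_volume_le (hd : 1 ≤ d) (hρ : IsSmallRadius d ρ)
    {A : Set (Eucl (d + 1))} (hA : MeasurableSet A) (hAΩ : A ⊆ tangentBall d ρ) :
    2 * volume A ≤ volume (barrierGrad d ρ '' A) := by
  have := mul_volume_le_volume_image hA (c := 2) (F := barrierGrad d ρ) (H := barrierHess d ρ)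
    (fun x hx => ?_)
    ((injOn_of_lt_of_ne fun x hx y hy hxy => hρ.barrier_lt hx hy hxy).mono hAΩ)
    (fun x hx => by simpa using hρ.two_le_det_barrierHess hd (hAΩ hx))
  · simpa using this
  · have h := last_pos_of_mem hρ.pos (hAΩ hx)
    have hL := hρ.one_le _ h (last_le_of_mem_closure hρ.pos (subset_closure (hAΩ hx)))
    exact hasFDerivAt_barrierGrad h (by linarith)

end Barrier

end

/-! ### The boundary data are of class `C²`. -/

section

/-- The default value `invLog 0 = 0` agrees with the limit at `0`. -/
theorem continuousAt_invLog_zero : ContinuousAt invLog 0 := by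
  have h : Tendsto invLog (𝓝[≠] 0) (𝓝 0) :=
    tendsto_inv_atTop_zero.comp (tendsto_neg_atBot_atTop.comp Real.tendsto_log_nhdsNE_zero)
  rw [continuousAt_iff_punctured_nhds]
  simpa [invLog] using h

variable {n : ℕ} {ρ : ℝ}

/-- Since `G → 0`, `G y • y = o(|y|)`. This handles both the first and the second derivative of the
data at the origin, where the chain rule through `log` is unavailable. -/
theorem hasFDerivAt_smul_self_zero {G : Eucl n → ℝ} (hG : ContinuousAt G 0) (hG0 : G 0 = 0) :
    HasFDerivAt (fun y => G y • y) (0 : Eucl n →L[ℝ] Eucl n) 0 := by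
  rw [hasFDerivAt_iff_isLittleO_nhds_zero]
  have h1 : G =o[𝓝 0] fun _ => (1 : ℝ) := by
    rw [isLittleO_one_iff, ← hG0]; exact hG
  simpa [hG0] using h1.smul_isBigO (isBigO_refl (fun y : Eucl n => y) (𝓝 0))

/-- `|y|² / (2ρ)`, which is the last coordinate of `y` on the boundary of `B_ρ(ρ e_n)`. -/
def sqHeight (ρ : ℝ) (y : Eucl n) : ℝ := ‖y‖ ^ 2 / (2 * ρ)

/-- The function `s ↦ s / (-log s)` of `sqHeight`. -/
def radialData (ρ : ℝ) (y : Eucl n) : ℝ := sqHeight ρ y * invLog (sqHeight ρ y)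

/-- The derivative of `s / (-log s)` at `sqHeight`. -/
def radialSlope (ρ : ℝ) (y : Eucl n) : ℝ :=
  invLog (sqHeight ρ y) + invLog (sqHeight ρ y) ^ 2

/-- The gradient of `radialData`. -/
def radialGrad (ρ : ℝ) (y : Eucl n) : Eucl n := (radialSlope ρ y / ρ) • y

/-- The Hessian of `radialData`. -/
def radialHess (ρ : ℝ) (y : Eucl n) : Eucl n →L[ℝ] Eucl n :=
  (radialSlope ρ y / ρ) • ContinuousLinearMap.id ℝ (Eucl n) +
    (invLog₁ (sqHeight ρ y) * (1 + 2 * invLog (sqHeight ρ y)) / ρ ^ 2) •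
      (innerSL ℝ y).smulRight y

theorem continuous_sqHeight : Continuous (sqHeight ρ : Eucl n → ℝ) := by
  unfold sqHeight; fun_prop

theorem sqHeight_zero : sqHeight ρ (0 : Eucl n) = 0 := by simp [sqHeight]

theorem hasFDerivAt_sqHeight (y : Eucl n) :
    HasFDerivAt (sqHeight ρ) ((1 / ρ) • innerSL ℝ y) y := by
  refine ((hasStrictFDerivAt_norm_sq y).hasFDerivAt.mul_const (1 / (2 * ρ))).congr_fderiv ?_
    |>.congr_of_eventuallyEq (Eventually.of_forall fun y => ?_)
  · ext v; simp; ring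
  · simp [sqHeight, div_eq_mul_inv]

theorem continuousAt_invLog_sqHeight_zero :
    ContinuousAt (fun y : Eucl n => invLog (sqHeight ρ y)) 0 := by
  have h : ContinuousAt invLog (sqHeight ρ (0 : Eucl n)) := by
    rw [sqHeight_zero]
    exact continuousAt_invLog_zero
  exact h.comp continuous_sqHeight.continuousAt

theorem invLog_zero : invLog 0 = 0 := by simp [invLog]

theorem continuousAt_radialSlope_zero :
    ContinuousAt (fun y : Eucl n => radialSlope ρ y / ρ) 0 :=
  (continuousAt_invLog_sqHeight_zero.add (continuousAt_invLog_sqHeight_zero.pow 2)).div_const ρ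

theorem sqHeight_pos (hρ : 0 < ρ) {y : Eucl n} (hy : y ≠ 0) : 0 < sqHeight ρ y := by
  have := norm_pos_iff.2 hy
  unfold sqHeight
  positivity

theorem neg_log_sqHeight_pos (hρ : 0 < ρ) {y : Eucl n} (hy : y ≠ 0) (hy1 : sqHeight ρ y < 1) :
    0 < -Real.log (sqHeight ρ y) :=
  neg_pos.2 (Real.log_neg (sqHeight_pos hρ hy) hy1)

theorem mul_invLog₁ {s : ℝ} (hs : s ≠ 0) : s * invLog₁ s = invLog s ^ 2 := by
  rw [invLog₁, invLog, mul_inv, mul_inv_cancel_left₀ hs, inv_pow]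

theorem hasFDerivAt_radialData (hρ : 0 < ρ) {y : Eucl n} (hy1 : sqHeight ρ y < 1) :
    HasFDerivAt (radialData ρ) (innerSL ℝ (radialGrad ρ y)) y := by
  by_cases hy : y = 0
  · subst hy
    have hG : ContinuousAt (fun y : Eucl n => invLog (sqHeight ρ y) / (2 * ρ)) 0 :=
      continuousAt_invLog_sqHeight_zero.div_const _
    have h := (hasFDerivAt_smul_self_zero hG (by simp [sqHeight_zero, invLog_zero])).inner ℝ
      (hasFDerivAt_id (𝕜 := ℝ) (0 : Eucl n))
    refine (h.congr_fderiv ?_).congr_of_eventuallyEq (Eventually.of_forall fun y => ?_)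
    · ext v; simp [radialGrad, sqHeight_zero, invLog_zero]
    · simp only [id, real_inner_smul_left, real_inner_self_eq_norm_sq, radialData, sqHeight]
      ring
  · have hs := sqHeight_pos hρ hy
    have h := (hasFDerivAt_sqHeight (ρ := ρ) y).mul
      ((hasDerivAt_invLog hs (neg_log_sqHeight_pos hρ hy hy1)).comp_hasFDerivAt y
        (hasFDerivAt_sqHeight y))
    refine h.congr_fderiv ?_
    ext v
    have := mul_invLog₁ hs.ne'
    simp only [radialGrad, radialSlope, ← this, add_apply, smul_apply, innerSL_apply_apply,
      smul_eq_mul, real_inner_smul_left, Function.comp_apply]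
    ring

theorem hasFDerivAt_radialGrad (hρ : 0 < ρ) {y : Eucl n} (hy1 : sqHeight ρ y < 1) :
    HasFDerivAt (radialGrad ρ) (radialHess ρ y) y := by
  by_cases hy : y = 0
  · subst hy
    refine (hasFDerivAt_smul_self_zero continuousAt_radialSlope_zero
      (by simp [radialSlope, sqHeight_zero, invLog_zero])).congr_fderiv ?_
    ext v; simp [radialHess, radialSlope, sqHeight_zero, invLog_zero]
  · have hs := sqHeight_pos hρ hy
    have h1 := (hasDerivAt_invLog hs (neg_log_sqHeight_pos hρ hy hy1)).comp_hasFDerivAt y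
        (hasFDerivAt_sqHeight y)
    have h2 := ((h1.add (h1.pow 2)).mul_const (1 / ρ)).smul (hasFDerivAt_id (𝕜 := ℝ) y)
    refine (h2.congr_fderiv ?_).congr_of_eventuallyEq (Eventually.of_forall fun y => ?_)
    · ext v i
      simp [radialHess, radialSlope]
      ring
    · simp [radialGrad, radialSlope, div_eq_mul_inv]

theorem continuousAt_radialHess (hρ : 0 < ρ) {y : Eucl n} (hy1 : sqHeight ρ y < 1) :
    ContinuousAt (radialHess ρ) y := by
  have hop : Continuous fun y : Eucl n => (innerSL ℝ y).smulRight y :=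
    (ContinuousLinearMap.smulRightL ℝ (Eucl n) (Eucl n)).continuous₂.comp
      ((innerSL ℝ).continuous.prodMk continuous_id)
  by_cases hy : y = 0
  · subst hy
    have h1 : ContinuousAt (fun y : Eucl n => (radialSlope ρ y / ρ) •
        ContinuousLinearMap.id ℝ (Eucl n)) 0 := continuousAt_radialSlope_zero.smul_const _
    refine h1.add ?_
    have h0 : (invLog₁ (sqHeight ρ (0 : Eucl n)) * (1 + 2 * invLog (sqHeight ρ (0 : Eucl n))) /
        ρ ^ 2) • (innerSL ℝ (0 : Eucl n)).smulRight (0 : Eucl n) = 0 := by ext v; simp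
    have hlim : ContinuousAt (fun y : Eucl n => 2 * |invLog (sqHeight ρ y) ^ 2 *
        (1 + 2 * invLog (sqHeight ρ y))| / ρ) 0 := by
      have := continuousAt_invLog_sqHeight_zero (n := n) (ρ := ρ)
      exact (((this.pow 2).mul ((this.const_mul 2).const_add 1)).abs.const_mul 2).div_const ρ
    rw [ContinuousAt, h0]
    refine squeeze_zero_norm (fun y => ?_) (by
      simpa [ContinuousAt, sqHeight_zero, invLog_zero] using hlim)
    rw [norm_smul, ContinuousLinearMap.norm_smulRight_apply, innerSL_apply_norm, Real.norm_eq_abs]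
    by_cases hy : y = 0
    · subst hy; simp; positivity
    -- The factor `|y|²` of the rank one term compensates the singularity of `invLog₁`, because `s *
    -- invLog₁ s = invLog s ^ 2` tends to `0`.
    · have h3 : ‖y‖ * ‖y‖ = 2 * ρ * sqHeight ρ y := by unfold sqHeight; field_simp
      have hs := sqHeight_pos hρ hy
      have hm : 0 ≤ invLog₁ (sqHeight ρ y) := inv_nonneg.2 (by positivity)
      rw [← mul_invLog₁ hs.ne', h3, abs_div, abs_of_pos (pow_pos hρ 2), abs_mul,
        abs_of_nonneg hm]
      refine le_of_eq ?_
      field_simp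
  · have hs := sqHeight_pos hρ hy
    have hL := neg_log_sqHeight_pos hρ hy hy1
    have h1 : ContinuousAt (fun y : Eucl n => invLog (sqHeight ρ y)) y :=
      (hasDerivAt_invLog hs hL).continuousAt.comp continuous_sqHeight.continuousAt
    have h2 : ContinuousAt (fun y : Eucl n => invLog₁ (sqHeight ρ y)) y :=
      (hasDerivAt_invLog₁ hs hL).continuousAt.comp continuous_sqHeight.continuousAt
    exact (((h1.add (h1.pow 2)).div_const ρ).smul_const _).add
      (((h2.mul ((h1.const_mul 2).const_add 1)).div_const (ρ ^ 2)).smul hop.continuousAt)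

theorem contDiffOn_radialData (hρ : 0 < ρ) :
    ContDiffOn ℝ 2 (radialData ρ : Eucl n → ℝ) {y | sqHeight ρ y < 1} := by
  have hU : IsOpen {y : Eucl n | sqHeight ρ y < 1} := isOpen_lt continuous_sqHeight continuous_const
  have h1 : ContDiffOn ℝ 1 (radialGrad ρ : Eucl n → Eucl n) {y | sqHeight ρ y < 1} := by
    rw [show (1 : WithTop ℕ∞) = 0 + 1 from (zero_add 1).symm,
      contDiffOn_succ_iff_fderiv_of_isOpen hU]
    refine ⟨fun y hy => (hasFDerivAt_radialGrad hρ hy).differentiableAt.differentiableWithinAt,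
      by simp, ?_⟩
    rw [contDiffOn_zero]
    refine ContinuousOn.congr (fun y hy => (continuousAt_radialHess hρ hy).continuousWithinAt)
      fun y hy => (hasFDerivAt_radialGrad hρ hy).fderiv
  rw [show (2 : WithTop ℕ∞) = 1 + 1 from one_add_one_eq_two.symm,
    contDiffOn_succ_iff_fderiv_of_isOpen hU]
  refine ⟨fun y hy => (hasFDerivAt_radialData hρ hy).differentiableAt.differentiableWithinAt,
    by simp, ?_⟩
  exact ((innerSL ℝ).contDiff.comp_contDiffOn h1).congr
    fun y hy => (hasFDerivAt_radialData hρ hy).fderiv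

theorem IsSmallRadius.c2OnHypersurface_logData {d : ℕ} (hρ : IsSmallRadius d ρ) :
    C2OnHypersurface (frontier (tangentBall d ρ)) (logData d) := by
  have hρ0 := hρ.pos
  have hh : ∀ y ∈ frontier (tangentBall d ρ), sqHeight ρ y = y (Fin.last d) := fun y hy => by
    rw [sqHeight, (mem_frontier_tangentBall hρ0).1 hy]; field_simp
  refine fun x hx => ⟨{y | sqHeight ρ y < 1}, isOpen_lt continuous_sqHeight continuous_const, ?_,
    radialData ρ, contDiffOn_radialData hρ0, fun y hy => ?_⟩
  -- The whole sphere lies in the domain: `-log x_n ≥ 1` for `0 < x_n ≤ 2ρ` forces `x_n < 1`.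
  · rw [mem_ofPred_eq, hh x hx]
    have hxc := frontier_subset_closure hx
    have h1 := last_le_of_mem_closure hρ0 hxc
    rcases (last_nonneg_of_mem_closure hρ0 hxc).eq_or_lt with h | h
    · rw [← h]; exact one_pos
    · by_contra hge
      have h2 := hρ.one_le _ h h1
      have h3 := Real.log_nonneg (not_lt.1 hge)
      linarith
  · rw [radialData, hh y hy.2, logData, invLog, div_eq_mul_inv]

end

/-! ### Behaviour of solutions at the origin. -/

section

variable {d : ℕ} {ρ : ℝ}

/-- The barrier serves as obstacle, with slopes bounded by `3`. -/
theorem IsSmallRadius.exists_isDirichletSolution (hd : 1 ≤ d) (hρ : IsSmallRadius d ρ) :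
    ∃ u : Eucl (d + 1) → ℝ,
      IsDirichletSolution (tangentBall d ρ) (fun _ => 1) (logData d) u := by
  have h0 : (0 : Eucl (d + 1)) ∈ frontier (tangentBall d ρ) := by
    simp [mem_frontier_tangentBall hρ.pos]
  obtain ⟨u, hu⟩ := MongeAmpere.exists_isDirichletSolution (Ω := tangentBall d ρ)
    Metric.isOpen_ball (convex_ball _ _) Metric.isBounded_ball ⟨0, h0⟩ (R := 3)
    hρ.continuousOn_barrier (fun x hx => hρ.isSubgradient_barrier hx)
    (fun x hx => by simpa using hρ.norm_barrierGrad_le hx)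
    (fun A hA hAΩ => le_trans (by rw [two_mul]; exact le_self_add)
      (hρ.two_mul_volume_le hd hA hAΩ))
  exact ⟨u, hu.convexOn, hu.continuousOn, hu.detHessian_eq, fun x hx =>
    (hu.eq_boundary x hx).trans (barrier_eq_logData hρ.pos hx)⟩

/-- The properties of a solution that its regularity at the origin depends on. -/
structure IsTrapped (d : ℕ) (ρ : ℝ) (u : Eucl (d + 1) → ℝ) : Prop where
  small : IsSmallRadius d ρ
  convexOn : ConvexOn ℝ (closure (tangentBall d ρ)) u
  boundary : ∀ x ∈ frontier (tangentBall d ρ), u x = x (Fin.last d) * invLog (x (Fin.last d))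
  barrier_le : ∀ x ∈ closure (tangentBall d ρ), barrier d ρ x ≤ u x

theorem IsDirichletSolution.isTrapped (hd : 1 ≤ d) (hρ : IsSmallRadius d ρ)
    {u : Eucl (d + 1) → ℝ}
    (hu : IsDirichletSolution (tangentBall d ρ) (fun _ => 1) (logData d) u) :
    IsTrapped d ρ u where
  small := hρ
  convexOn := hu.convexOn
  boundary := fun x hx => by rw [hu.eq_boundary x hx, logData, invLog, div_eq_mul_inv]
  barrier_le := hu.le_of_subsolution Metric.isOpen_ball Metric.isBounded_ball
    hρ.continuousOn_barrier (fun x hx => (barrier_eq_logData hρ.pos hx).le)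
    (fun x hx => hρ.isSubgradient_barrier hx) (fun A hA hAΩ => hρ.two_mul_volume_le hd hA hAΩ)

theorem norm_sq_add_smul {v : Eucl (d + 1)} (hv : ‖v‖ = 1) (hv0 : v (Fin.last d) = 0) (a b : ℝ) :
    ‖a • lastVec d + b • v‖ ^ 2 = a ^ 2 + b ^ 2 := by
  rw [norm_add_sq_real, norm_smul, norm_smul, hv, norm_lastVec, real_inner_smul_left,
    real_inner_smul_right, inner_lastVec, hv0, Real.norm_eq_abs, Real.norm_eq_abs]
  simp

theorem last_add_smul {v : Eucl (d + 1)} (hv0 : v (Fin.last d) = 0) (a b : ℝ) :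
    (a • lastVec d + b • v) (Fin.last d) = a := by simp [hv0, lastVec_last]

theorem smul_lastVec_last (t : ℝ) : (t • lastVec d) (Fin.last d) = t := by simp [lastVec_last]

theorem norm_smul_lastVec (t : ℝ) : ‖t • lastVec d‖ ^ 2 = t ^ 2 := by
  rw [norm_smul, norm_lastVec, mul_one, Real.norm_eq_abs, sq_abs]

theorem smul_lastVec_mem_closure (hρ : 0 < ρ) {t : ℝ} (ht : 0 ≤ t) (ht' : t ≤ 2 * ρ) :
    t • lastVec d ∈ closure (tangentBall d ρ) := by
  rw [mem_closure_tangentBall hρ, norm_smul_lastVec, smul_lastVec_last, sq]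
  exact mul_le_mul_of_nonneg_right ht' ht

theorem smul_lastVec_mem (hρ : 0 < ρ) {t : ℝ} (ht : 0 < t) (ht' : t < 2 * ρ) :
    t • lastVec d ∈ tangentBall d ρ := by
  rw [mem_tangentBall hρ, norm_smul_lastVec, smul_lastVec_last, sq]
  exact mul_lt_mul_of_pos_right ht' ht

/-- The function `t ↦ t^δ (-log t)` is infinitesimal, so a multiple of `t^(1+δ)` does not bound
`t / (2 (-log t))` near `0`. -/
theorem not_eventually_le_rpow {δ : ℝ} (hδ : 0 < δ) (C : ℝ) :
    ¬ ∀ᶠ t in 𝓝[>] (0 : ℝ), t / (2 * (-Real.log t)) ≤ C * t ^ (1 + δ) := by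
  intro h
  have h1 : Tendsto (fun t : ℝ => 2 * C * -(Real.log t * t ^ δ)) (𝓝[>] 0) (𝓝 0) := by
    simpa using (tendsto_log_mul_rpow_nhdsGT_zero hδ).neg.const_mul (2 * C)
  have h2 : ∀ᶠ t in 𝓝[>] (0 : ℝ), Real.log t ≤ -1 :=
    Real.tendsto_log_nhdsGT_zero.eventually_le_atBot (-1)
  obtain ⟨t, ht, ht1, ht2, ht0⟩ := (h.and ((h1.eventually_lt_const one_pos).and
    (h2.and self_mem_nhdsWithin))).exists
  have ht0 : 0 < t := ht0
  have hL : 0 < -Real.log t := by linarith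
  rw [div_le_iff₀ (by positivity), Real.rpow_add ht0, Real.rpow_one] at ht
  have h3 : t * (2 * C * -(Real.log t * t ^ δ)) < t * 1 := mul_lt_mul_of_pos_left ht1 ht0
  linarith

namespace IsTrapped

variable {u : Eucl (d + 1) → ℝ} (hu : IsTrapped d ρ u)

include hu

theorem zero_mem_frontier : (0 : Eucl (d + 1)) ∈ frontier (tangentBall d ρ) := by
  simp [mem_frontier_tangentBall hu.small.pos]

theorem map_zero : u 0 = 0 := by
  rw [hu.boundary 0 hu.zero_mem_frontier]; simp

theorem nonneg {x : Eucl (d + 1)} (hx : x ∈ closure (tangentBall d ρ)) : 0 ≤ u x :=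
  (hu.small.barrier_nonneg hx).trans (hu.barrier_le x hx)

theorem le_axis {t : ℝ} (ht : 0 < t) (ht' : t ≤ 2 * ρ) :
    t / (2 * (-Real.log t)) ≤ u (t • lastVec d) := by
  refine le_trans ?_ (hu.barrier_le _ (smul_lastVec_mem_closure hu.small.pos ht.le ht'))
  have hρ := hu.small.pos
  have hL := hu.small.one_le t ht ht'
  rw [barrier, quadWeight, norm_smul_lastVec, smul_lastVec_last, invLog, mul_add]
  have : 0 ≤ (-Real.log t)⁻¹ * (t ^ 2 / (4 * ρ)) :=
    mul_nonneg (inv_nonneg.2 (by linarith)) (by positivity)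
  have h2 : t / (2 * (-Real.log t)) = (-Real.log t)⁻¹ * (t / 2) := by
    rw [div_eq_mul_inv, mul_inv]; ring
  linarith

/-- The point `t e_n` is the midpoint of two boundary points of the same height `t`; `1 ≤ d`
provides the horizontal direction. -/
theorem axis_le (hd : 1 ≤ d) {t : ℝ} (ht : 0 ≤ t) (ht' : t ≤ 2 * ρ) :
    u (t • lastVec d) ≤ t * invLog t := by
  have hρ := hu.small.pos
  set v : Eucl (d + 1) := EuclideanSpace.single 0 1
  have hv : ‖v‖ = 1 := by simp [v]
  have hv0 : v (Fin.last d) = 0 := by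
    have : Fin.last d ≠ 0 := by
      rw [Ne, Fin.ext_iff]; simp; omega
    simp [v, this]
  have hr : 0 ≤ 2 * ρ * t - t ^ 2 := by nlinarith
  have hmem : ∀ b : ℝ, b ^ 2 = 2 * ρ * t - t ^ 2 →
      t • lastVec d + b • v ∈ frontier (tangentBall d ρ) := fun b hb => by
    rw [mem_frontier_tangentBall hρ, norm_sq_add_smul hv hv0, last_add_smul hv0, hb]
    ring
  set r := √(2 * ρ * t - t ^ 2)
  have h1 := hmem r (Real.sq_sqrt hr)
  have h2 := hmem (-r) (by rw [neg_sq]; exact Real.sq_sqrt hr)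
  have h3 := hu.convexOn.2 (frontier_subset_closure h1) (frontier_subset_closure h2)
    (by norm_num : (0 : ℝ) ≤ 1 / 2) (by norm_num : (0 : ℝ) ≤ 1 / 2) (by norm_num)
  rw [hu.boundary _ h1, hu.boundary _ h2, last_add_smul hv0, last_add_smul hv0] at h3
  have h4 : (1 / 2 : ℝ) • (t • lastVec d + r • v) + (1 / 2 : ℝ) • (t • lastVec d + -r • v) =
      t • lastVec d := by module
  rw [h4, smul_eq_mul] at h3
  linarith

theorem eventually_axis_mem : ∀ᶠ t in 𝓝[>] (0 : ℝ), 0 < t ∧ t ≤ 2 * ρ := by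
  filter_upwards [Ioc_mem_nhdsGT (show (0 : ℝ) < 2 * ρ by linarith [hu.small.pos])] with t ht
  exact ht

omit hu in
theorem tendsto_invLog : Tendsto invLog (𝓝[>] 0) (𝓝 0) := by
  have := continuousAt_invLog_zero.tendsto
  rw [invLog_zero] at this
  exact this.mono_left nhdsWithin_le_nhds

theorem isSubgradient_smul_le (hd : 1 ≤ d) {c : ℝ}
    (h : IsSubgradient (closure (tangentBall d ρ)) u 0 (c • lastVec d)) : c ≤ 0 := by
  refine ge_of_tendsto tendsto_invLog ?_
  filter_upwards [hu.eventually_axis_mem] with t ht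
  have h1 := h _ (smul_lastVec_mem_closure hu.small.pos ht.1.le ht.2)
  rw [hu.map_zero, sub_zero, zero_add, real_inner_smul_left, inner_lastVec,
    smul_lastVec_last] at h1
  have h2 := h1.trans (hu.axis_le hd ht.1.le ht.2)
  rw [mul_comm] at h2
  exact le_of_mul_le_mul_left h2 ht.1

theorem isSubgradient_zero : IsSubgradient (closure (tangentBall d ρ)) u 0 0 := fun x hx => by
  simpa [hu.map_zero] using hu.nonneg hx

/-- Along the sphere the height is quadratic in the tangential distance, and so are the data, being
at most the height. A tangential component of `p` would grow linearly. -/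
theorem isSubgradient_eq_smul {p : Eucl (d + 1)}
    (h : IsSubgradient (closure (tangentBall d ρ)) u 0 p) :
    p = p (Fin.last d) • lastVec d := by
  have hρ := hu.small.pos
  set q := p - p (Fin.last d) • lastVec d
  have hq0 : q (Fin.last d) = 0 := by simp [q, lastVec_last]
  by_contra hne
  have hq : 0 < ‖q‖ := norm_pos_iff.2 (sub_ne_zero.2 hne)
  set v := ‖q‖⁻¹ • q
  have hv : ‖v‖ = 1 := by
    rw [norm_smul, norm_inv, norm_norm, inv_mul_cancel₀ hq.ne']
  have hv0 : v (Fin.last d) = 0 := by simp [v, hq0]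
  have hpv : inner ℝ p v = ‖q‖ := by
    have : p = q + p (Fin.last d) • lastVec d := by simp [q]
    rw [this, inner_add_left, real_inner_smul_left, inner_lastVec, hv0, mul_zero, add_zero,
      real_inner_smul_right, real_inner_self_eq_norm_sq]
    field_simp
  have key : ∀ κ : ℝ, 0 < κ → ‖q‖ ≤ κ * (1 - p (Fin.last d)) := by
    intro κ hκ
    -- Chosen so that the ray of slope `κ` over the direction `v` meets the sphere at height `c κ²`.
    set c := 2 * ρ / (1 + κ ^ 2)
    have hc : 0 < c := by positivity
    have hx : (c * κ ^ 2) • lastVec d + (c * κ) • v ∈ frontier (tangentBall d ρ) := by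
      rw [mem_frontier_tangentBall hρ, norm_sq_add_smul hv hv0, last_add_smul hv0]
      simp only [c]
      field_simp
      ring
    have hxc := frontier_subset_closure hx
    have h1 := h _ hxc
    have h2 : c * κ ^ 2 ≤ 2 * ρ := by
      have := last_le_of_mem_closure hρ hxc
      rwa [last_add_smul hv0] at this
    rw [hu.boundary _ hx, hu.map_zero, last_add_smul hv0, sub_zero, zero_add, inner_add_right,
      real_inner_smul_right, real_inner_smul_right, hpv, real_inner_comm, inner_lastVec] at h1
    have h3 : invLog (c * κ ^ 2) ≤ 1 :=
      inv_le_one_of_one_le₀ (hu.small.one_le _ (by positivity) h2)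
    have h4 : c * κ ^ 2 * invLog (c * κ ^ 2) ≤ c * κ ^ 2 :=
      mul_le_of_le_one_right (by positivity) h3
    have h5 : (c * κ) * ‖q‖ ≤ (c * κ) * (κ * (1 - p (Fin.last d))) := by linarith
    exact le_of_mul_le_mul_left h5 (by positivity)
  have h6 : Tendsto (fun κ : ℝ => κ * (1 - p (Fin.last d))) (𝓝[>] 0) (𝓝 0) := by
    have : Tendsto (fun κ : ℝ => κ * (1 - p (Fin.last d))) (𝓝 0) (𝓝 (0 * _)) :=
      tendsto_id.mul_const _
    rw [zero_mul] at this
    exact this.mono_left nhdsWithin_le_nhds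
  have h7 := ge_of_tendsto h6 (eventually_mem_nhdsWithin.mono fun κ hκ => key κ hκ)
  linarith

/-- Subgradients at `0` are of the form `c e_n` with `c ≤ 0`. If `c < 0`, the slope can still be
raised to `0`, so only `0` is extremal. -/
theorem isBoundaryGradient_iff (hd : 1 ≤ d) (p : Eucl (d + 1)) :
    IsBoundaryGradient (closure (tangentBall d ρ)) u 0 (lastVec d) p ↔ p = 0 := by
  constructor
  · rintro ⟨h1, h2⟩
    have h3 := hu.isSubgradient_eq_smul h1
    have h4 := hu.isSubgradient_smul_le hd (h3 ▸ h1)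
    rcases h4.eq_or_lt with h5 | h5
    · rw [h3, h5, zero_smul]
    · refine absurd ?_ (h2 (-p (Fin.last d)) (neg_pos.2 h5))
      rw [h3, smul_lastVec_last, ← add_smul, add_neg_cancel, zero_smul]
      exact hu.isSubgradient_zero
  · rintro rfl
    refine ⟨hu.isSubgradient_zero, fun ε hε h => ?_⟩
    rw [zero_add] at h
    exact absurd (hu.isSubgradient_smul_le hd h) (not_le.2 hε)

theorem hasDerivWithinAt_axis (hd : 1 ≤ d) :
    HasDerivWithinAt (fun t : ℝ => u (t • lastVec d)) 0 (Ici 0) 0 := by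
  rw [hasDerivWithinAt_iff_isLittleO, isLittleO_iff]
  intro c hc
  have h1 : ∀ᶠ t in 𝓝[≥] (0 : ℝ), invLog t ≤ c := by
    refine nhdsWithin_le_nhds (continuousAt_invLog_zero.eventually_le_const ?_)
    rwa [invLog_zero]
  filter_upwards [h1, Icc_mem_nhdsGE (show (0 : ℝ) < 2 * ρ by linarith [hu.small.pos])] with t ht ht'
  have h2 := hu.nonneg (smul_lastVec_mem_closure hu.small.pos ht'.1 ht'.2)
  have h3 := hu.axis_le hd ht'.1 ht'.2
  simp only [zero_smul, hu.map_zero, sub_zero, smul_zero]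
  rw [Real.norm_of_nonneg h2, Real.norm_of_nonneg ht'.1]
  nlinarith [ht'.1]

theorem tendsto_axis_div (hd : 1 ≤ d) :
    Tendsto (fun t : ℝ => u (t • lastVec d) / t) (𝓝[>] 0) (𝓝 0) := by
  refine squeeze_zero' ?_ ?_ tendsto_invLog <;>
    filter_upwards [hu.eventually_axis_mem] with t ht
  · exact div_nonneg (hu.nonneg (smul_lastVec_mem_closure hu.small.pos ht.1.le ht.2)) ht.1.le
  · rw [div_le_iff₀ ht.1, mul_comm]
    exact hu.axis_le hd ht.1.le ht.2

theorem not_eventually_axis_le {δ : ℝ} (hδ : 0 < δ) (C : ℝ) :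
    ¬ ∀ᶠ t in 𝓝[>] (0 : ℝ), u (t • lastVec d) ≤ C * t ^ (1 + δ) := fun h =>
  not_eventually_le_rpow hδ C <| (h.and hu.eventually_axis_mem).mono fun _ ht =>
    (hu.le_axis ht.2.1 ht.2.2).trans ht.1

omit hu in
-- Restricting to a line turns `P` into a univariate polynomial of degree at most one.
theorem exists_eval_smul_eq (P : MvPolynomial (Fin (d + 1)) ℝ) (hP : P.totalDegree ≤ 1)
    (v : Eucl (d + 1)) :
    ∃ a b : ℝ, ∀ t : ℝ, MvPolynomial.eval (fun i => (t • v) i) P = a * t + b := by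
  let Q : Polynomial ℝ := MvPolynomial.aeval (fun i => Polynomial.C (v i) * Polynomial.X) P
  have hQ : Q.natDegree ≤ 1 := by
    simpa using MvPolynomial.aeval_natDegree_le P hP
      (fun i => Polynomial.C (v i) * Polynomial.X) (n := 1)
      fun i => (Polynomial.natDegree_C_mul_le _ _).trans Polynomial.natDegree_X_le
  obtain ⟨a, b, hab⟩ := Polynomial.exists_eq_X_add_C_of_natDegree_le_one hQ
  refine ⟨a, b, fun t => ?_⟩
  have h : Q.eval t = MvPolynomial.eval (fun i => (t • v) i) P := by
    change Polynomial.evalRingHom t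
      (MvPolynomial.aeval (fun i => Polynomial.C (v i) * Polynomial.X) P) = _
    rw [MvPolynomial.aeval_def, MvPolynomial.hom_eval₂, MvPolynomial.eval, MvPolynomial.eval₂Hom]
    change MvPolynomial.eval₂ _ _ P = MvPolynomial.eval₂ _ _ P
    congr 1
    · ext; simp
    · funext i
      change Polynomial.eval t _ = t * v i
      rw [Polynomial.eval_mul, Polynomial.eval_C, Polynomial.eval_X, mul_comm]
  rw [← h, hab]
  simp

/-- On the axis the value and slope of `u` at `0` vanish, which kills the affine polynomial there.
What is left contradicts the logarithmic lower bound. -/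
theorem not_pointwiseHolder (hd : 1 ≤ d) {δ : ℝ} (hδ : 0 < δ) :
    ¬ PointwiseHolder 1 δ (closure (tangentBall d ρ)) u 0 := by
  rintro ⟨P, hP, hO⟩
  obtain ⟨a, b, hab⟩ := exists_eval_smul_eq P hP (lastVec d)
  have hlim : Tendsto (fun t : ℝ => t • lastVec d) (𝓝[>] 0) (𝓝[closure (tangentBall d ρ)] 0) := by
    refine tendsto_nhdsWithin_iff.2 ⟨?_, hu.eventually_axis_mem.mono fun t ht =>
      smul_lastVec_mem_closure hu.small.pos ht.1.le ht.2⟩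
    have : Continuous fun t : ℝ => t • lastVec d := by fun_prop
    simpa using (this.tendsto 0).mono_left (nhdsWithin_le_nhds (s := Ioi 0))
  obtain ⟨C, hC⟩ := (hO.comp_tendsto hlim).bound
  have hbound : ∀ᶠ t in 𝓝[>] (0 : ℝ), |u (t • lastVec d) - (a * t + b)| ≤ C * t ^ (1 + δ) := by
    filter_upwards [hC, hu.eventually_axis_mem] with t ht ht0
    simp only [Function.comp_apply, hab, sub_zero, norm_smul, norm_lastVec, mul_one,
      Real.norm_eq_abs, Nat.cast_one] at ht
    rwa [abs_of_pos ht0.1, abs_of_pos (Real.rpow_pos_of_pos ht0.1 _)] at ht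
  have hid : Tendsto (fun t : ℝ => t) (𝓝[>] 0) (𝓝 0) := tendsto_id.mono_left nhdsWithin_le_nhds
  have hpow : ∀ γ : ℝ, 0 < γ → Tendsto (fun t : ℝ => C * t ^ γ) (𝓝[>] 0) (𝓝 0) := fun γ hγ => by
    have := ((Real.continuousAt_rpow_const 0 γ (Or.inr hγ.le)).tendsto.mono_left
      (nhdsWithin_le_nhds (s := Ioi 0))).const_mul C
    rwa [Real.zero_rpow hγ.ne', mul_zero] at this
  have hdiv := hu.tendsto_axis_div hd
  have hu0 : Tendsto (fun t : ℝ => u (t • lastVec d)) (𝓝[>] 0) (𝓝 0) := by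
    have := hdiv.mul hid
    rw [mul_zero] at this
    exact this.congr' (hu.eventually_axis_mem.mono fun t ht => div_mul_cancel₀ _ ht.1.ne')
  have hb : b = 0 := by
    have h1 : Tendsto (fun t => u (t • lastVec d) - (a * t + b)) (𝓝[>] 0) (𝓝 (0 - (a * 0 + b))) :=
      hu0.sub ((hid.const_mul a).add_const b)
    have h2 := squeeze_zero_norm' (f := fun t => u (t • lastVec d) - (a * t + b)) hbound
      (hpow (1 + δ) (by linarith))
    have := tendsto_nhds_unique h1 h2
    linarith
  have ha : a = 0 := by
    have h1 : Tendsto (fun t => u (t • lastVec d) / t - a) (𝓝[>] 0) (𝓝 (0 - a)) :=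
      hdiv.sub_const a
    have h2 : Tendsto (fun t => u (t • lastVec d) / t - a) (𝓝[>] 0) (𝓝 0) := by
      refine squeeze_zero_norm' ?_ (hpow δ hδ)
      filter_upwards [hbound, hu.eventually_axis_mem] with t ht ht0
      rw [hb, add_zero, Real.rpow_add ht0.1, Real.rpow_one] at ht
      have : u (t • lastVec d) / t - a = (u (t • lastVec d) - a * t) / t := by
        rw [sub_div, mul_div_cancel_right₀ _ ht0.1.ne']
      rw [this, Real.norm_eq_abs, abs_div, abs_of_pos ht0.1, div_le_iff₀ ht0.1]
      linarith
    have := tendsto_nhds_unique h1 h2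
    linarith
  refine hu.not_eventually_axis_le hδ C (hbound.mono fun t ht => ?_)
  rw [ha, hb, zero_mul, add_zero, sub_zero] at ht
  exact (le_abs_self _).trans ht

theorem not_globallyC1Holder (hd : 1 ≤ d) {δ : ℝ} (hδ : 0 < δ) :
    ¬ GloballyC1Holder δ (tangentBall d ρ) u := by
  rintro ⟨hdiff, C, hC⟩
  have hρ := hu.small.pos
  set g : ℝ → ℝ := fun t => u (t • lastVec d)
  set γ : ℝ → ℝ := fun t => inner ℝ (gradient u (t • lastVec d)) (lastVec d)
  have hgc : ConvexOn ℝ (Icc 0 (2 * ρ)) g := by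
    refine ⟨convex_Icc _ _, fun s hs t ht a b ha hb hab => ?_⟩
    have := hu.convexOn.2 (smul_lastVec_mem_closure hρ hs.1 hs.2)
      (smul_lastVec_mem_closure hρ ht.1 ht.2) ha hb hab
    simp only [g]
    rwa [smul_smul, smul_smul, ← add_smul] at this
  have hg' : ∀ t, 0 < t → t < 2 * ρ → HasDerivAt g (γ t) t := fun t ht ht' => by
    have h1 : HasDerivAt (fun t : ℝ => t • lastVec d) (lastVec d) t := by
      simpa using (hasDerivAt_id t).smul_const (lastVec d)
    have := (hdiff _ (smul_lastVec_mem hρ ht ht')).hasGradientAt.hasFDerivAt.comp_hasDerivAt t h1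
    simpa [Function.comp_def, g, γ] using this
  have hγC : ∀ s t, 0 < s → s < t → t < 2 * ρ → γ t ≤ γ s + |C| * t ^ δ := by
    intro s t hs hst ht
    have h1 := hC _ (smul_lastVec_mem hρ (hs.trans hst) ht) _
      (smul_lastVec_mem (d := d) hρ hs (hst.trans ht))
    rw [← sub_smul, norm_smul, norm_lastVec, mul_one, Real.norm_of_nonneg (by linarith)] at h1
    have h2 : γ t - γ s ≤ ‖gradient u (t • lastVec d) - gradient u (s • lastVec d)‖ := by
      simp only [γ]
      rw [← inner_sub_left]
      simpa [norm_lastVec] using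
        real_inner_le_norm (gradient u (t • lastVec d) - gradient u (s • lastVec d)) (lastVec d)
    have h3 : (t - s) ^ δ ≤ t ^ δ := Real.rpow_le_rpow (by linarith) (by linarith) hδ.le
    have h4 : C * (t - s) ^ δ ≤ |C| * t ^ δ :=
      mul_le_mul (le_abs_self C) h3 (Real.rpow_nonneg (by linarith) _) (abs_nonneg C)
    linarith
  have hg0 : g 0 = 0 := by simp [g, hu.map_zero]
  -- Convexity bounds the derivative at `s` by the secant slope over `[s, 2s]`, where `u ≥ 0` at `s`
  -- and the upper bound holds at `2s`.
  have hγ0 : ∀ s, 0 < s → 2 * s ≤ 2 * ρ → γ s ≤ 2 * invLog (2 * s) := by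
    intro s hs hs'
    have h1 := hgc.le_slope_of_hasDerivAt (x := s) (y := 2 * s) ⟨hs.le, by linarith⟩
      ⟨by linarith, hs'⟩ (by linarith) (hg' s hs (by linarith))
    have h2 : 0 ≤ g s := hu.nonneg (smul_lastVec_mem_closure hρ hs.le (by linarith))
    have h3 : g (2 * s) ≤ 2 * s * invLog (2 * s) := hu.axis_le hd (by linarith) hs'
    rw [slope_def_field, le_div_iff₀ (by linarith)] at h1
    have h4 : s * γ s ≤ s * (2 * invLog (2 * s)) := by linarith
    exact le_of_mul_le_mul_left h4 hs
  refine hu.not_eventually_axis_le hδ |C| ?_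
  filter_upwards [Ioo_mem_nhdsGT (show (0 : ℝ) < 2 * ρ by linarith)] with t ht
  -- Let `s → 0` in the Hölder estimate; the contribution of `γ s` is at most `0` in the limit.
  have h1 : γ t ≤ |C| * t ^ δ := by
    have hlim : Tendsto (fun s : ℝ => 2 * invLog (2 * s) + |C| * t ^ δ) (𝓝[>] 0)
        (𝓝 (2 * 0 + |C| * t ^ δ)) := by
      refine ((tendsto_invLog.comp ?_).const_mul 2).add_const _
      refine tendsto_nhdsWithin_iff.2 ⟨?_, eventually_mem_nhdsWithin.mono fun s hs => ?_⟩
      · have : Continuous fun s : ℝ => 2 * s := by fun_prop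
        simpa using (this.tendsto 0).mono_left (nhdsWithin_le_nhds (s := Ioi 0))
      · exact mul_pos two_pos (mem_Ioi.1 hs)
    rw [mul_zero, zero_add] at hlim
    refine ge_of_tendsto hlim ?_
    filter_upwards [Ioo_mem_nhdsGT (lt_min ht.1 hρ)] with s hs
    have hs1 := hs.2.trans_le (min_le_left _ _)
    have hs2 := hs.2.trans_le (min_le_right _ _)
    have := hγC s t hs.1 hs1 ht.2
    have := hγ0 s hs.1 (by linarith)
    linarith
  -- The secant slope from `0` is at most `γ t`, so `u(t e_n) ≤ |C| t^(1+δ)`, against the lower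
  -- bound.
  have h2 := hgc.slope_le_of_hasDerivAt (x := 0) (y := t) ⟨le_rfl, by linarith⟩
    ⟨ht.1.le, ht.2.le⟩ ht.1 (hg' t ht.1 ht.2)
  rw [slope_def_field, hg0, sub_zero, sub_zero, div_le_iff₀ ht.1] at h2
  rw [Real.rpow_add ht.1, Real.rpow_one]
  have h3 := mul_le_mul_of_nonneg_right h1 ht.1.le
  change g t ≤ _
  linarith

end IsTrapped

end

end MongeAmpere

end

theorem mainTheorem5 (d : ℕ) (hd : 1 ≤ d) :
    ∃ ρ₀ : ℝ, 0 < ρ₀ ∧ ρ₀ ≤ 1 / 2 ∧ ∀ ρ : ℝ, 0 < ρ → ρ < ρ₀ →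
      -- the boundary data are of class `C²`
      MongeAmpere.C2OnHypersurface (frontier (MongeAmpere.tangentBall d ρ))
        (MongeAmpere.logData d) ∧
      -- the Dirichlet problem has a solution
      (∃ u : MongeAmpere.Eucl (d + 1) → ℝ,
        MongeAmpere.IsDirichletSolution (MongeAmpere.tangentBall d ρ) (fun _ => 1)
          (MongeAmpere.logData d) u) ∧
      -- and every solution behaves as claimed at the origin
      ∀ u : MongeAmpere.Eucl (d + 1) → ℝ,
        MongeAmpere.IsDirichletSolution (MongeAmpere.tangentBall d ρ) (fun _ => 1)
          (MongeAmpere.logData d) u →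
        -- `∇u(0) = 0`, in particular `u_n(0) = 0`, also as a one-sided derivative
        (∀ p : MongeAmpere.Eucl (d + 1),
          MongeAmpere.IsBoundaryGradient (closure (MongeAmpere.tangentBall d ρ)) u 0
            (MongeAmpere.lastVec d) p ↔ p = 0) ∧
        HasDerivWithinAt (fun t : ℝ => u (t • MongeAmpere.lastVec d)) 0 (Set.Ici 0) 0 ∧
        -- the lower bound on the axis
        (∀ t : ℝ, 0 < t → t ≤ 2 * ρ →
          t / (2 * (-Real.log t)) ≤ u (t • MongeAmpere.lastVec d)) ∧
        -- failure of pointwise and of global `C^{1,δ}` regularity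
        ∀ δ : ℝ, 0 < δ → δ < 1 →
          ¬ MongeAmpere.PointwiseHolder 1 δ (closure (MongeAmpere.tangentBall d ρ)) u 0 ∧
          ¬ MongeAmpere.GloballyC1Holder δ (MongeAmpere.tangentBall d ρ) u := by
  obtain ⟨ρ₀, h0, h1, h⟩ := MongeAmpere.exists_isSmallRadius d
  refine ⟨ρ₀, h0, h1, fun ρ hρ hρ' => ?_⟩
  have hsm := h ρ hρ hρ'
  refine ⟨hsm.c2OnHypersurface_logData, hsm.exists_isDirichletSolution hd, fun u hu => ?_⟩
  have ht := hu.isTrapped hd hsm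
  exact ⟨ht.isBoundaryGradient_iff hd, ht.hasDerivWithinAt_axis hd, fun t => ht.le_axis,
    fun δ hδ _ => ⟨ht.not_pointwiseHolder hd hδ, ht.not_globallyC1Holder hd hδ⟩⟩
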